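/- A graph here is a finite loopless graph in which multiple edges are allowed; $e(G)$ is the number of its edges, counted with multiplicity. Regard every edge as a unit resistor, and let $R_{xy}$ be the effective resistance between the vertices $x$ and $y$, that is, the potential difference between $x$ and $y$ when a unit current enters at $x$ and leaves at $y$ ($R_{xy}=\infty$ if $x$ and $y$ lie in different components). For a graph $G$ with vertex set $V$, $|V|=n$, put $$A(G)=\frac1{\binom n2}\sum_{\{x,y\}\subseteq V,\ x\ne y}R_{xy},\qquad A'(G)=\frac1{n^2}\sum_{(x,y)\in V\times V}R_{xy},$$ and for a graph $G$ with a distinguished root vertex $\rho$ put $$B(G)=\frac1{|V|-1}\sum_{x\in V}R_{\rho x}.$$ For real $\alpha$ let $$a_n(\alpha)=\min\{A'(G): |V(G)|=n,\ e(G)\le \alpha n/2\},\qquad b_n(\alpha)=\min\{B(G): G \text{ rooted},\ |V(G)|=n+1,\ e(G)\le\alpha n/2\},$$ and let $a(\alpha)=\lim_{n\to\infty}a_n(\alpha)$ and $b(\alpha)=\lim_{n\to\infty}b_n(\alpha)$. **Theorem.** For every real $\alpha\in[2,10/3]$ the limit $b(\alpha)$ exists and satisfies $$b(\alpha)\le 1-0.3546\,(\alpha-2).$$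 In particular $b(3)\le 0.6454$. Moreover the limit $a(3)$ exists and $a(3)\le 1.2908$. Finally, for all sufficiently large $n$ there is a graph $G$ with $n$ vertices, at most $3n/2$ edges and $A(G)<1.2908$. -/

import Mathlib

open Filter Topology
open scoped ENNReal

/-- A finite multigraph on the vertex set `V`: multiple edges are allowed, loops are not.
`mult s(x, y)` is the number of edges between `x` and `y`. -/
@[ext]
structure Multigraph (V : Type*) where
  mult : Sym2 V → ℕ
  loopless : ∀ x : V, mult s(x, x) = 0

namespace Multigraph

variable {V : Type*} [Fintype V] [DecidableEq V]

/-- The number `e(G)` of edges, counted with multiplicity. -/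
def numEdges (G : Multigraph V) : ℕ := ∑ e : Sym2 V, G.mult e

/-- Every edge has unit resistance, so by the law of Ohm the potential `φ` drives the current
`φ u - φ w` through each edge from `u` to `w`. This is the total current leaving `u`. -/
def netCurrent (G : Multigraph V) (φ : V → ℝ) (u : V) : ℝ :=
  ∑ w, (G.mult s(u, w) : ℝ) * (φ u - φ w)

/-- `φ` is a potential of a current flow in which a unit current enters the network at `x`, leaves
it at `y`, and the current law holds at all other vertices (for `x = y`: at all vertices). -/
def IsUnitPotential (G : Multigraph V) (x y : V) (φ : V → ℝ) : Prop :=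
  ∀ u, G.netCurrent φ u = (if u = x then 1 else 0) - (if u = y then 1 else 0)

/-- The potential drop from `x` to `y` is the same for all potentials of a unit current flow
from `x` to `y`. -/
theorem IsUnitPotential.drop_unique {G : Multigraph V} {x y : V} {φ ψ : V → ℝ}
    (hφ : G.IsUnitPotential x y φ) (hψ : G.IsUnitPotential x y ψ) :
    φ x - φ y = ψ x - ψ y := by
  have key : ∀ f g : V → ℝ, G.IsUnitPotential x y g →
      ∑ u, f u * G.netCurrent g u = f x - f y := by
    intro f g hg
    unfold IsUnitPotential at hg
    simp only [hg, mul_sub, Finset.sum_sub_distrib, mul_ite, mul_one, mul_zero,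
      Finset.sum_ite_eq', Finset.mem_univ, if_true]
  have sym : ∑ u, φ u * G.netCurrent ψ u = ∑ u, ψ u * G.netCurrent φ u := by
    rw [← sub_eq_zero, ← Finset.sum_sub_distrib]
    have h : ∀ u, φ u * G.netCurrent ψ u - ψ u * G.netCurrent φ u
        = ∑ w, (G.mult s(u, w) : ℝ) * (ψ u * φ w - φ u * ψ w) := by
      intro u
      simp only [netCurrent, Finset.mul_sum, ← Finset.sum_sub_distrib]
      exact Finset.sum_congr rfl fun w _ => by ring
    simp only [h]
    have h2 : ∑ u, ∑ w, (G.mult s(u, w) : ℝ) * (ψ u * φ w - φ u * ψ w)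
        = - ∑ u, ∑ w, (G.mult s(u, w) : ℝ) * (ψ u * φ w - φ u * ψ w) := by
      conv_lhs => rw [Finset.sum_comm]
      simp only [← Finset.sum_neg_distrib]
      refine Finset.sum_congr rfl fun u _ => Finset.sum_congr rfl fun w _ => ?_
      rw [Sym2.eq_swap]
      ring
    linarith
  rw [← key φ ψ hψ, ← key ψ φ hφ, sym]

/-- The effective resistance `R_{xy}`: the potential drop `φ x - φ y` of the unit current flow from
`x` to `y`. The infimum runs over a single value if `x` and `y` are in the same component, and over
the empty set, which gives `∞`, otherwise. -/
noncomputable def resistance (G : Multigraph V) (x y : V) : ℝ≥0∞ :=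
  ⨅ (φ : V → ℝ) (_ : G.IsUnitPotential x y φ), ENNReal.ofReal (φ x - φ y)

/-- `A(G)`: the average resistance over all pairs of distinct vertices. -/
noncomputable def avgResistance {n : ℕ} (G : Multigraph (Fin n)) : ℝ≥0∞ :=
  (∑ x : Fin n, ∑ y : Fin n with x < y, G.resistance x y) / (n.choose 2 : ℝ≥0∞)

/-- `A'(G)`: the average resistance over all ordered pairs of (not necessarily distinct)
vertices. -/
noncomputable def avgResistance' {n : ℕ} (G : Multigraph (Fin n)) : ℝ≥0∞ :=
  (∑ x : Fin n, ∑ y : Fin n, G.resistance x y) / (n : ℝ≥0∞) ^ 2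

/-- `B(G)` for the graph `G` with root `ρ` and `n` further vertices: the average resistance of a
non-root vertex to the root. -/
noncomputable def rootedResistance {n : ℕ} (G : Multigraph (Fin (n + 1))) (ρ : Fin (n + 1)) :
    ℝ≥0∞ :=
  (∑ x, G.resistance ρ x) / (n : ℝ≥0∞)

end Multigraph

/-- `a_n(α)`: the minimum of `A'(G)` over graphs with `n` vertices and at most `α n / 2` edges
(there are finitely many of them, so that the infimum is attained if there are any). -/
noncomputable def optResistance (α : ℝ) (n : ℕ) : ℝ≥0∞ :=
  ⨅ (G : Multigraph (Fin n)) (_ : (G.numEdges : ℝ) ≤ α * n / 2), G.avgResistance'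

/-- `b_n(α)`: the minimum of `B(G)` over rooted graphs with `n` non-root vertices and at most
`α n / 2` edges (again an infimum over finitely many graphs). -/
noncomputable def optRootedResistance (α : ℝ) (n : ℕ) : ℝ≥0∞ :=
  ⨅ (G : Multigraph (Fin (n + 1))) (ρ : Fin (n + 1)) (_ : (G.numEdges : ℝ) ≤ α * n / 2),
    G.rootedResistance ρ

/-- `a(α) = lim a_n(α)`; meaningful where the limit exists. -/
noncomputable def asympResistance (α : ℝ) : ℝ≥0∞ := limUnder atTop (optResistance α)

/-- `b(α) = lim b_n(α)`; meaningful where the limit exists. -/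
noncomputable def asympRootedResistance (α : ℝ) : ℝ≥0∞ := limUnder atTop (optRootedResistance α)

/-!
The energy `∑ (φ u - φ w) ^ 2` of a potential, summed over the edges `uw`, governs everything: the
effective resistance `R_{xy}` is at most `r` if and only if `(φ x - φ y) ^ 2 ≤ r * energy φ` for all
potentials `φ`. Contractions, gluing and added edges are immediate in this form.

*The rooted limit.* Gluing rooted networks at their roots adds up vertices, edges and resistances to
the root, so `n b_n(α)` is subadditive and Fekete's lemma gives the limit
(`tendsto_optRootedResistance`). Gluing copies of one block to a star interpolates between the star
at `α = 2` and the block (`rootedLimit_le_of_block`).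

*The block.* It is a finite cover of the base graph with a vertex of degree 4, two vertices of
degree 3 and the edge multiplicities 2, 2, 1, so it has 5/3 edges per vertex. The voltages are
involutions that generate a permutation group without short relations, and a `ZMod M` component;
the vertices over the vertex of degree 4 with `ZMod M` component `0`, a fraction `1 / (3 M)` of all,
are joined to the root. Around each vertex the cover looks like a tree, and the energy on that tree
bounds the energy in the network from below (`Cover.treeEnergy_le`). Every branch of the tree meets
an edge to the root within `2 M + 1` steps (`Cover.grounded`), so that the conductances of deep
branches are positive, and the series-parallel recursion halves their relative error to the fixed
point at every level (`Cover.branchCond_le_treeEnergy_succ`). At the fixed point the vertices of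
degree 3 and 4 have resistance `√5 / 4` and `3 (√5 - 1) / 8` to the root, with average
`(7 √5 - 3) / 24 < 0.52719`.

*The unrooted limit* is twice the rooted one. From rooted to unrooted, the sum of all `R_{xy}` is
at most `2 N` times the sum of the resistances to the root (`HasRooted.exists_sum_resistance_le`).
Conversely, ground an unrooted network at a set `S`, with Green kernel `g`. Then
`2 N tr g ≤ ∑ R_{xy} + 2 ∑ g_x(y)`, and only the last sum has to be shown to be of lower order. Each
further grounded vertex `v` lowers `tr g` by `‖g_v‖² / g_v(v)`, so within `s` steps this
decrease is at most `1 / s` of the trace for all `v`, which makes the Frobenius norm of `g` small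
(`exists_isGreen_frobenius_le`). Then `S` is contracted to the root (`exists_hasRooted`); with
`s = ⌊√n⌋` the contraction loses a negligible number of vertices (`le_optResistance`).
-/

/-! ### The Dirichlet form and effective resistances -/

namespace Multigraph

variable {V : Type*}

/-- The product of the increments of `f` and of `φ` along an edge. -/
def edgeProd (f φ : V → ℝ) : Sym2 V → ℝ :=
  Sym2.lift ⟨fun u w => (f u - f w) * (φ u - φ w), fun u w => by ring⟩

@[simp] theorem edgeProd_mk (f φ : V → ℝ) (u w : V) :
    edgeProd f φ s(u, w) = (f u - f w) * (φ u - φ w) := rfl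

variable [Fintype V]

/-- The Dirichlet form of the network: the sum of `(f u - f w) * (φ u - φ w)` over all edges `uw`,
here written as the pairing of `f` with the currents that `φ` injects (see `energy_eq_sum_sym2`). -/
def energy (G : Multigraph V) (f φ : V → ℝ) : ℝ := ∑ u, f u * G.netCurrent φ u

theorem netCurrent_sub (G : Multigraph V) (φ ψ : V → ℝ) (u : V) :
    G.netCurrent (φ - ψ) u = G.netCurrent φ u - G.netCurrent ψ u := by
  simp only [netCurrent, ← Finset.sum_sub_distrib, Pi.sub_apply]
  exact Finset.sum_congr rfl fun w _ => by ring

theorem netCurrent_smul (G : Multigraph V) (c : ℝ) (φ : V → ℝ) (u : V) :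
    G.netCurrent (c • φ) u = c * G.netCurrent φ u := by
  simp only [netCurrent, Finset.mul_sum, Pi.smul_apply, smul_eq_mul]
  exact Finset.sum_congr rfl fun w _ => by ring

theorem netCurrent_add (G : Multigraph V) (φ ψ : V → ℝ) (u : V) :
    G.netCurrent (φ + ψ) u = G.netCurrent φ u + G.netCurrent ψ u := by
  simp only [netCurrent, ← Finset.sum_add_distrib, Pi.add_apply]
  exact Finset.sum_congr rfl fun w _ => by ring

theorem netCurrent_sub_const (G : Multigraph V) (φ : V → ℝ) (c : ℝ) (u : V) :
    G.netCurrent (fun v => φ v - c) u = G.netCurrent φ u := by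
  simp [netCurrent]

theorem energy_eq_sum_sum (G : Multigraph V) (f φ : V → ℝ) :
    2 * G.energy f φ = ∑ u, ∑ w, (G.mult s(u, w) : ℝ) * edgeProd f φ s(u, w) := by
  have h1 : G.energy f φ = ∑ u, ∑ w, (G.mult s(u, w) : ℝ) * (f u * (φ u - φ w)) := by
    simp only [energy, netCurrent, Finset.mul_sum]
    exact Finset.sum_congr rfl fun u _ => Finset.sum_congr rfl fun w _ => by ring
  have h2 : G.energy f φ = ∑ u, ∑ w, (G.mult s(u, w) : ℝ) * (f w * (φ w - φ u)) := by
    rw [h1, Finset.sum_comm]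
    exact Finset.sum_congr rfl fun u _ => Finset.sum_congr rfl fun w _ => by rw [Sym2.eq_swap]
  rw [two_mul]
  nth_rewrite 1 [h1]
  rw [h2, ← Finset.sum_add_distrib]
  refine Finset.sum_congr rfl fun u _ => ?_
  rw [← Finset.sum_add_distrib]
  refine Finset.sum_congr rfl fun w _ => ?_
  rw [edgeProd_mk]; ring

theorem energy_sub_right (G : Multigraph V) (f φ ψ : V → ℝ) :
    G.energy f (φ - ψ) = G.energy f φ - G.energy f ψ := by
  simp only [energy, netCurrent_sub, mul_sub, Finset.sum_sub_distrib]

theorem energy_smul_right (G : Multigraph V) (f φ : V → ℝ) (c : ℝ) :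
    G.energy f (c • φ) = c * G.energy f φ := by
  simp only [energy, netCurrent_smul, Finset.mul_sum]
  exact Finset.sum_congr rfl fun w _ => by ring

theorem energy_sum_right (G : Multigraph V) {ι : Type*} (a : Finset ι) (f : V → ℝ)
    (φ : ι → V → ℝ) : G.energy f (∑ i ∈ a, φ i) = ∑ i ∈ a, G.energy f (φ i) := by
  classical
  induction a using Finset.induction_on with
  | empty => simp [energy, netCurrent]
  | insert i a hi ih =>
    rw [Finset.sum_insert hi, Finset.sum_insert hi, ← ih]
    simp only [energy, netCurrent_add, mul_add, Finset.sum_add_distrib]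

variable [DecidableEq V]

theorem sum_sum_sym2 (F : Sym2 V → ℝ) (hF : ∀ x, F s(x, x) = 0) :
    ∑ u, ∑ w, F s(u, w) = 2 * ∑ p, F p := by
  rw [← Fintype.sum_prod_type' (fun u w => F s(u, w)),
    ← Finset.sum_fiberwise (s := Finset.univ) (g := fun x : V × V => s(x.1, x.2)),
    Finset.mul_sum]
  refine Finset.sum_congr rfl fun p _ => ?_
  induction p using Sym2.inductionOn with
  | hf a b =>
    have h1 : ∀ x ∈ Finset.univ.filter (fun x : V × V => s(x.1, x.2) = s(a, b)),
        F s(x.1, x.2) = F s(a, b) := fun x hx => by rw [(Finset.mem_filter.1 hx).2]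
    rw [Finset.sum_congr rfl h1, Finset.sum_const, nsmul_eq_mul]
    by_cases hab : a = b
    · subst hab; simp [hF]
    · have : Finset.univ.filter (fun x : V × V => s(x.1, x.2) = s(a, b)) = {(a, b), (b, a)} := by
        ext ⟨c, d⟩
        simp
      rw [this, Finset.card_pair (by simp [hab])]
      norm_num

theorem energy_eq_sum_sym2 (G : Multigraph V) (f φ : V → ℝ) :
    G.energy f φ = ∑ p, (G.mult p : ℝ) * edgeProd f φ p := by
  have := sum_sum_sym2 (fun p => (G.mult p : ℝ) * edgeProd f φ p) (by simp)
  rw [← energy_eq_sum_sum] at this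
  linarith

/-- The edges of a multigraph are listed, with arbitrary orientations. -/
theorem exists_edges (G : Multigraph V) : ∃ s t : Fin G.numEdges → V, ∀ f φ : V → ℝ,
    G.energy f φ = ∑ e, (f (s e) - f (t e)) * (φ (s e) - φ (t e)) := by
  have hc : Fintype.card (Σ p : Sym2 V, Fin (G.mult p)) = G.numEdges := by
    simp [numEdges]
  let eqv := Fintype.equivFinOfCardEq hc
  refine ⟨fun e => (eqv.symm e).1.out.1, fun e => (eqv.symm e).1.out.2, fun f φ => ?_⟩
  have h : ∀ p : Sym2 V, edgeProd f φ p = (f p.out.1 - f p.out.2) * (φ p.out.1 - φ p.out.2) := by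
    intro p
    conv_lhs => rw [← Quot.out_eq p]
    rfl
  rw [Equiv.sum_comp eqv.symm (fun q : Σ p : Sym2 V, Fin (G.mult p) =>
      (f q.1.out.1 - f q.1.out.2) * (φ q.1.out.1 - φ q.1.out.2)),
    Fintype.sum_sigma, energy_eq_sum_sym2]
  refine Finset.sum_congr rfl fun p _ => ?_
  rw [h]; simp

/-- The multigraph with the edges `s e, t e`; an edge whose ends agree is dropped. -/
def ofEdges {E : Type*} [Fintype E] (s t : E → V) : Multigraph V where
  mult p := (Finset.univ.filter fun e => s(s e, t e) = p ∧ s e ≠ t e).card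
  loopless x := by
    rw [Finset.card_eq_zero, Finset.filter_eq_empty_iff]
    rintro e - ⟨h1, h2⟩
    rw [Sym2.eq_iff] at h1
    exact h2 (by rcases h1 with h | h <;> rw [h.1, h.2])

theorem numEdges_ofEdges_le {E : Type*} [Fintype E] (s t : E → V) :
    (ofEdges s t).numEdges ≤ Fintype.card E := by
  rw [← Finset.card_univ,
    Finset.card_eq_sum_card_fiberwise (f := fun e => s(s e, t e)) (t := Finset.univ)
      (fun _ _ => Finset.mem_univ _)]
  refine Finset.sum_le_sum fun p _ => Finset.card_le_card fun e he => ?_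
  simp only [Finset.mem_filter] at he ⊢
  exact ⟨he.1, he.2.1⟩

theorem energy_ofEdges {E : Type*} [Fintype E] (s t : E → V) (f φ : V → ℝ) :
    (ofEdges s t).energy f φ = ∑ e, (f (s e) - f (t e)) * (φ (s e) - φ (t e)) := by
  rw [energy_eq_sum_sym2, ← Finset.sum_fiberwise (s := Finset.univ) (g := fun e => s(s e, t e))]
  refine Finset.sum_congr rfl fun p _ => ?_
  simp only [ofEdges]
  rw [Finset.card_filter, Nat.cast_sum, Finset.sum_mul, Finset.sum_filter]
  refine Finset.sum_congr rfl fun e _ => ?_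
  by_cases h : s(s e, t e) = p
  · subst h
    by_cases h' : s e = t e <;> simp [h']
  · simp [h]

theorem energy_comm (G : Multigraph V) (f φ : V → ℝ) : G.energy f φ = G.energy φ f := by
  obtain ⟨s, t, h⟩ := G.exists_edges
  simp only [h, mul_comm]

theorem energy_self_nonneg (G : Multigraph V) (φ : V → ℝ) : 0 ≤ G.energy φ φ := by
  obtain ⟨s, t, h⟩ := G.exists_edges
  rw [h]
  exact Finset.sum_nonneg fun e _ => mul_self_nonneg _

theorem energy_sq_le (G : Multigraph V) (f φ : V → ℝ) :
    G.energy f φ ^ 2 ≤ G.energy f f * G.energy φ φ := by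
  obtain ⟨s, t, h⟩ := G.exists_edges
  simp only [h, ← sq]
  exact Finset.sum_mul_sq_le_sq_mul_sq _ _ _

theorem energy_sum_left (G : Multigraph V) {ι : Type*} (a : Finset ι) (f : ι → V → ℝ)
    (φ : V → ℝ) : G.energy (∑ i ∈ a, f i) φ = ∑ i ∈ a, G.energy (f i) φ := by
  rw [energy_comm, energy_sum_right]
  exact Finset.sum_congr rfl fun i _ => G.energy_comm _ _

theorem IsUnitPotential.energy_eq {G : Multigraph V} {x y : V} {φ : V → ℝ}
    (hφ : G.IsUnitPotential x y φ) (f : V → ℝ) : G.energy f φ = f x - f y := by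
  unfold IsUnitPotential at hφ
  simp only [energy, hφ, mul_sub, Finset.sum_sub_distrib, mul_ite, mul_one, mul_zero,
    Finset.sum_ite_eq', Finset.mem_univ, if_true]

theorem IsUnitPotential.sub {G : Multigraph V} {x y z : V} {φ ψ : V → ℝ}
    (hφ : G.IsUnitPotential x z φ) (hψ : G.IsUnitPotential y z ψ) :
    G.IsUnitPotential x y (φ - ψ) := fun u => by
  rw [netCurrent_sub, hφ u, hψ u]; ring

theorem IsUnitPotential.neg {G : Multigraph V} {x y : V} {φ : V → ℝ}
    (hφ : G.IsUnitPotential x y φ) : G.IsUnitPotential y x (-φ) := fun u => by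
  have := G.netCurrent_smul (-1) φ u
  rw [neg_one_smul] at this
  rw [this, hφ u]; ring

theorem IsUnitPotential.sub_const {G : Multigraph V} {x y : V} {φ : V → ℝ}
    (hφ : G.IsUnitPotential x y φ) (c : ℝ) : G.IsUnitPotential x y (fun v => φ v - c) := fun u => by
  rw [netCurrent_sub_const, hφ u]

/-- The Laplacian is symmetric, so its range is the annihilator of its kernel. -/
theorem exists_isUnitPotential (G : Multigraph V) (x y : V)
    (h : ∀ φ, G.energy φ φ = 0 → φ x = φ y) : ∃ φ, G.IsUnitPotential x y φ := by
  let L : (V → ℝ) →ₗ[ℝ] (V → ℝ) :=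
    { toFun := G.netCurrent
      map_add' := fun φ ψ => funext fun u => G.netCurrent_add φ ψ u
      map_smul' := fun c φ => funext fun u => G.netCurrent_smul c φ u }
  by_contra hne
  have hmem : (Pi.single x 1 - Pi.single y 1 : V → ℝ) ∉ LinearMap.range L := by
    rintro ⟨φ, hφ⟩
    refine hne ⟨φ, fun u => ?_⟩
    have := congrFun hφ u
    simpa [L, Pi.single_apply] using this
  obtain ⟨f, hf, hL⟩ := Submodule.exists_le_ker_of_notMem hmem
  have hfe : ∀ ψ : V → ℝ, f ψ = ∑ u, f (Pi.single u 1) * ψ u := by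
    intro ψ
    rw [LinearMap.pi_apply_eq_sum_univ f ψ]
    refine Finset.sum_congr rfl fun u _ => ?_
    rw [smul_eq_mul, mul_comm]
    congr 2
    ext j; simp [Pi.single_apply, eq_comm]
  have h0 := h (fun u => f (Pi.single u 1)) (by
    have : f (L fun u => f (Pi.single u 1)) = 0 := hL ⟨_, rfl⟩
    rwa [hfe] at this)
  rw [map_sub, sub_ne_zero] at hf
  exact hf h0

theorem resistance_eq {G : Multigraph V} {x y : V} {φ : V → ℝ} (hφ : G.IsUnitPotential x y φ) :
    G.resistance x y = ENNReal.ofReal (φ x - φ y) := by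
  refine le_antisymm (iInf₂_le φ hφ) (le_iInf₂ fun ψ hψ => ?_)
  rw [hφ.drop_unique hψ]

theorem exists_isUnitPotential_of_resistance_ne_top {G : Multigraph V} {x y : V}
    (h : G.resistance x y ≠ ⊤) : ∃ φ, G.IsUnitPotential x y φ := by
  by_contra hne
  push Not at hne
  exact h (by simp [resistance, hne])

theorem resistance_comm (G : Multigraph V) (x y : V) : G.resistance x y = G.resistance y x := by
  have key : ∀ x y, G.resistance x y ≤ G.resistance y x := fun x y =>
    le_iInf₂ fun ψ hψ => (iInf₂_le _ hψ.neg).trans_eq (by congr 1; simp; ring)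
  exact le_antisymm (key x y) (key y x)

/-- The Dirichlet principle: an inequality that holds for all potentials bounds the effective
resistance. -/
theorem exists_isUnitPotential_le {G : Multigraph V} {x y : V} {r : ℝ} (hr : 0 ≤ r)
    (h : ∀ φ, (φ x - φ y) ^ 2 ≤ r * G.energy φ φ) :
    ∃ φ, G.IsUnitPotential x y φ ∧ φ x - φ y ≤ r := by
  obtain ⟨φ, hφ⟩ := G.exists_isUnitPotential x y fun φ h0 => by
    have := h φ
    rw [h0, mul_zero] at this
    exact sub_eq_zero.1 (pow_eq_zero_iff two_ne_zero |>.1 (le_antisymm this (sq_nonneg _)))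
  refine ⟨φ, hφ, ?_⟩
  have h1 := h φ
  rw [hφ.energy_eq φ] at h1
  by_contra! hlt
  nlinarith

theorem IsUnitPotential.drop_nonneg {G : Multigraph V} {x y : V} {φ : V → ℝ}
    (hφ : G.IsUnitPotential x y φ) : 0 ≤ φ x - φ y :=
  hφ.energy_eq φ ▸ G.energy_self_nonneg φ

theorem IsUnitPotential.sq_sub_le {G : Multigraph V} {x y : V} {φ : V → ℝ}
    (hφ : G.IsUnitPotential x y φ) (f : V → ℝ) :
    (f x - f y) ^ 2 ≤ (φ x - φ y) * G.energy f f := by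
  have := G.energy_sq_le f φ
  rw [hφ.energy_eq f, hφ.energy_eq φ] at this
  linarith

theorem resistance_le {G : Multigraph V} {x y : V} {r : ℝ} (hr : 0 ≤ r)
    (h : ∀ φ, (φ x - φ y) ^ 2 ≤ r * G.energy φ φ) : G.resistance x y ≤ ENNReal.ofReal r := by
  obtain ⟨φ, hφ, hle⟩ := exists_isUnitPotential_le hr h
  rw [resistance_eq hφ]
  exact ENNReal.ofReal_le_ofReal hle

theorem sq_sub_le_of_resistance {G : Multigraph V} {x y : V} (h : G.resistance x y ≠ ⊤)
    (f : V → ℝ) : (f x - f y) ^ 2 ≤ (G.resistance x y).toReal * G.energy f f := by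
  obtain ⟨φ, hφ⟩ := exists_isUnitPotential_of_resistance_ne_top h
  rw [resistance_eq hφ, ENNReal.toReal_ofReal hφ.drop_nonneg]
  exact hφ.sq_sub_le f

end Multigraph

/-! ### Rooted networks and the limit of the rooted problem -/

open Multigraph

/-- There is a rooted network with `n` vertices besides the root `none` and with `m` edges
`s e, t e` in which the resistances to the root are at most `r`, with sum at most `T`. The
resistances enter through the Dirichlet principle. Loops are allowed here, as they carry no energy;
they serve to pad the number of edges. -/
def HasRooted (n m : ℕ) (T : ℝ) : Prop :=
  ∃ (s t : Fin m → Option (Fin n)) (r : Fin n → ℝ), (∀ i, 0 ≤ r i) ∧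
    (∀ i (φ : Option (Fin n) → ℝ),
      (φ (some i) - φ none) ^ 2 ≤ r i * ∑ e, (φ (s e) - φ (t e)) ^ 2) ∧ ∑ i, r i ≤ T

namespace HasRooted

theorem of_family {ι E : Type*} [Fintype ι] [Fintype E] (s t : E → Option ι) (r : ι → ℝ)
    (hr : ∀ i, 0 ≤ r i)
    (h : ∀ i (φ : Option ι → ℝ), (φ (some i) - φ none) ^ 2 ≤ r i * ∑ e, (φ (s e) - φ (t e)) ^ 2)
    {n m : ℕ} {T : ℝ} (hn : Fintype.card ι = n) (hm : Fintype.card E ≤ m) (hT : ∑ i, r i ≤ T) :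
    HasRooted n m T := by
  let a := Fintype.equivFinOfCardEq hn
  have hE : Fintype.card (E ⊕ Fin (m - Fintype.card E)) = m := by simp; omega
  let b := Fintype.equivFinOfCardEq hE
  refine ⟨fun e => Sum.elim (fun e => (s e).map a) (fun _ => none) (b.symm e),
    fun e => Sum.elim (fun e => (t e).map a) (fun _ => none) (b.symm e), fun i => r (a.symm i),
    fun i => hr _, fun i φ => ?_, ?_⟩
  · have h1 := h (a.symm i) (fun x => φ (x.map a))
    rw [Equiv.sum_comp b.symm (fun e : E ⊕ Fin (m - Fintype.card E) =>
      (φ (Sum.elim (fun e => (s e).map a) (fun _ => none) e) -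
        φ (Sum.elim (fun e => (t e).map a) (fun _ => none) e)) ^ 2), Fintype.sum_sum_type]
    simpa using h1
  · rw [Equiv.sum_comp a.symm r]; exact hT

theorem mono {n m m' : ℕ} {T T' : ℝ} (h : HasRooted n m T) (hm : m ≤ m') (hT : T ≤ T') :
    HasRooted n m' T' := by
  obtain ⟨s, t, r, hr, h, hs⟩ := h
  exact of_family s t r hr h (by simp) (by simpa using hm) (hs.trans hT)

theorem nonneg {n m : ℕ} {T : ℝ} (h : HasRooted n m T) : 0 ≤ T := by
  obtain ⟨s, t, r, hr, -, hs⟩ := h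
  exact (Finset.sum_nonneg fun i _ => hr i).trans hs

/-- Two rooted networks are glued at their roots. -/
theorem add {n m n' m' : ℕ} {T T' : ℝ} (h : HasRooted n m T) (h' : HasRooted n' m' T') :
    HasRooted (n + n') (m + m') (T + T') := by
  obtain ⟨s, t, r, hr, h, hs⟩ := h
  obtain ⟨s', t', r', hr', h', hs'⟩ := h'
  refine of_family (ι := Fin n ⊕ Fin n') (E := Fin m ⊕ Fin m')
    (Sum.elim (fun e => (s e).map Sum.inl) (fun e => (s' e).map Sum.inr))
    (Sum.elim (fun e => (t e).map Sum.inl) (fun e => (t' e).map Sum.inr)) (Sum.elim r r')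
    (by rintro (i | i) <;> simp [hr, hr']) ?_ (by simp) (by simp)
    (by simpa using add_le_add hs hs')
  intro i φ
  rw [Fintype.sum_sum_type]
  have p1 : 0 ≤ ∑ e, (φ ((s e).map Sum.inl) - φ ((t e).map Sum.inl)) ^ 2 :=
    Finset.sum_nonneg fun _ _ => sq_nonneg _
  have p2 : 0 ≤ ∑ e, (φ ((s' e).map Sum.inr) - φ ((t' e).map Sum.inr)) ^ 2 :=
    Finset.sum_nonneg fun _ _ => sq_nonneg _
  rcases i with i | i
  · exact (h i fun x => φ (x.map Sum.inl)).trans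
      (mul_le_mul_of_nonneg_left (le_add_of_nonneg_right p2) (hr i))
  · exact (h' i fun x => φ (x.map Sum.inr)).trans
      (mul_le_mul_of_nonneg_left (le_add_of_nonneg_left p1) (hr' i))

theorem star (n : ℕ) : HasRooted n n n := by
  refine ⟨fun e => some e, fun _ => none, fun _ => 1, fun _ => zero_le_one, fun i φ => ?_, by simp⟩
  rw [one_mul]
  exact Finset.single_le_sum (f := fun e : Fin n => (φ (some e) - φ none) ^ 2)
    (fun _ _ => sq_nonneg _) (Finset.mem_univ i)

theorem mul {n m : ℕ} {T : ℝ} (h : HasRooted n m T) (k : ℕ) :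
    HasRooted (k * n) (k * m) (k * T) := by
  induction k with
  | zero => simpa using star 0
  | succ k ih =>
    have := ih.add h
    rw [Nat.succ_mul, Nat.succ_mul]
    convert this using 1
    push_cast; ring

theorem exists_graph {n m : ℕ} {T : ℝ} (h : HasRooted n m T) :
    ∃ (G : Multigraph (Fin (n + 1))) (ρ : Fin (n + 1)) (r : Fin (n + 1) → ℝ), G.numEdges ≤ m ∧
      (∀ i, 0 ≤ r i) ∧ (∀ i φ, (φ i - φ ρ) ^ 2 ≤ r i * G.energy φ φ) ∧ ∑ i, r i ≤ T := by
  obtain ⟨s, t, r, hr, h, hs⟩ := h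
  let a : Option (Fin n) ≃ Fin (n + 1) := (finSuccEquiv n).symm
  refine ⟨ofEdges (fun e => a (s e)) (fun e => a (t e)), a none,
    fun i => (a.symm i).elim 0 r, (numEdges_ofEdges_le _ _).trans_eq (Fintype.card_fin m),
    fun i => ?_, fun i φ => ?_, ?_⟩
  · change 0 ≤ (a.symm i).elim 0 r
    cases a.symm i <;> simp [hr]
  · rw [energy_ofEdges]
    obtain ⟨j, rfl⟩ := a.surjective i
    simp only [Equiv.symm_apply_apply]
    cases j with
    | none => simp
    | some j => simpa [sq] using h j (fun x => φ (a x))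
  · rw [Equiv.sum_comp a.symm (fun i : Option (Fin n) => i.elim 0 r), Fintype.sum_option]
    simpa using hs

theorem of_graph {n m : ℕ} (G : Multigraph (Fin (n + 1))) (ρ : Fin (n + 1)) (hm : G.numEdges ≤ m)
    (h : ∑ i, G.resistance ρ i ≠ ⊤) : HasRooted n m (∑ i, G.resistance ρ i).toReal := by
  obtain ⟨s, t, hst⟩ := G.exists_edges
  have hne : ∀ i, G.resistance ρ i ≠ ⊤ := fun i => by
    rw [ENNReal.sum_ne_top] at h
    exact h i (Finset.mem_univ i)
  let a : Fin (n + 1) ≃ Option (Fin n) := finSuccEquiv' ρ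
  refine of_family (fun e => a (s e)) (fun e => a (t e))
    (fun i => (G.resistance ρ (a.symm (some i))).toReal) (fun i => ENNReal.toReal_nonneg) ?_
    (by simp) (by simpa using hm) ?_
  · intro i φ
    have h1 := sq_sub_le_of_resistance (hne (a.symm (some i))) (fun x => φ (a x))
    simp only [hst, ← sq, Equiv.apply_symm_apply] at h1
    have h2 : a ρ = none := finSuccEquiv'_at ρ
    rw [h2] at h1
    nlinarith
  · rw [ENNReal.toReal_sum fun i _ => hne i, ← Equiv.sum_comp a.symm, Fintype.sum_option]
    exact le_add_of_nonneg_left ENNReal.toReal_nonneg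

end HasRooted

/-- The infimum of the total resistance to the root of a rooted network with `n` further vertices
and at most `α n / 2` edges, as a real number. -/
noncomputable def minRooted (α : ℝ) (n : ℕ) : ℝ := sInf {T | HasRooted n ⌊α * n / 2⌋₊ T}

theorem bddBelow_hasRooted (n m : ℕ) : BddBelow {T | HasRooted n m T} := ⟨0, fun _ h => h.nonneg⟩

theorem minRooted_nonneg (α : ℝ) (n : ℕ) : 0 ≤ minRooted α n :=
  Real.sInf_nonneg fun _ h => h.nonneg

theorem minRooted_le {α : ℝ} {n m : ℕ} {T : ℝ} (h : HasRooted n m T) (hm : (m : ℝ) ≤ α * n / 2) :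
    minRooted α n ≤ T :=
  csInf_le (bddBelow_hasRooted _ _) (h.mono (Nat.le_floor hm) le_rfl)

theorem nonempty_hasRooted {α : ℝ} (hα : 2 ≤ α) (n : ℕ) :
    {T | HasRooted n ⌊α * n / 2⌋₊ T}.Nonempty :=
  ⟨n, (HasRooted.star n).mono (Nat.le_floor (by nlinarith [n.cast_nonneg (α := ℝ)])) le_rfl⟩

theorem subadditive_minRooted {α : ℝ} (hα : 2 ≤ α) : Subadditive (minRooted α) := by
  intro a b
  have key : ∀ T ∈ {T | HasRooted a ⌊α * a / 2⌋₊ T}, ∀ T' ∈ {T | HasRooted b ⌊α * b / 2⌋₊ T},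
      minRooted α (a + b) ≤ T + T' := by
    intro T hT T' hT'
    refine minRooted_le (HasRooted.add hT hT') ?_
    have h1 := Nat.floor_le (a := α * a / 2) (by positivity)
    have h2 := Nat.floor_le (a := α * b / 2) (by positivity)
    push_cast
    linarith
  have h1 : ∀ T ∈ {T | HasRooted a ⌊α * a / 2⌋₊ T}, minRooted α (a + b) - minRooted α b ≤ T :=
    fun T hT => by
      have := le_csInf (nonempty_hasRooted hα b) fun T' hT' =>
        sub_le_iff_le_add'.2 (key T hT T' hT')
      change _ ≤ minRooted α b at this
      linarith
  have := le_csInf (nonempty_hasRooted hα a) h1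
  change _ ≤ minRooted α a at this
  linarith

theorem optRootedResistance_eq {α : ℝ} (hα : 2 ≤ α) {n : ℕ} (hn : n ≠ 0) :
    optRootedResistance α n = ENNReal.ofReal (minRooted α n / n) := by
  have hn0 : (0 : ℝ) < n := by positivity
  apply le_antisymm
  · refine ENNReal.le_of_forall_pos_le_add fun ε hε _ => ?_
    obtain ⟨T, hT, hlt⟩ := exists_lt_of_csInf_lt (nonempty_hasRooted hα n)
      (show minRooted α n < minRooted α n + n * ε by
        have : (0 : ℝ) < ε := hε
        linarith [mul_pos hn0 this])
    obtain ⟨G, ρ, r, hm, hr, h, hs⟩ := HasRooted.exists_graph hT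
    refine (iInf_le_of_le G <| iInf_le_of_le ρ <| iInf_le_of_le ?_ le_rfl).trans ?_
    · exact (Nat.cast_le.2 hm).trans (Nat.floor_le (by positivity))
    · have hle : ∑ x, G.resistance ρ x ≤ ENNReal.ofReal T := by
        refine le_trans ?_ (ENNReal.ofReal_le_ofReal hs)
        rw [ENNReal.ofReal_sum_of_nonneg fun i _ => hr i]
        refine Finset.sum_le_sum fun i _ => ?_
        rw [resistance_comm]
        exact resistance_le (hr i) (h i)
      have h1 : G.rootedResistance ρ ≤ ENNReal.ofReal (T / n) := by
        rw [ENNReal.ofReal_div_of_pos hn0, ENNReal.ofReal_natCast]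
        exact ENNReal.div_le_div_right hle _
      refine h1.trans ?_
      have h2 : 0 ≤ minRooted α n / n := div_nonneg (minRooted_nonneg _ _) hn0.le
      rw [← ENNReal.ofReal_coe_nnreal, ← ENNReal.ofReal_add h2 ε.coe_nonneg]
      refine ENNReal.ofReal_le_ofReal ?_
      rw [div_add' _ _ _ hn0.ne']
      gcongr
      linarith
  · refine le_iInf fun G => le_iInf fun ρ => le_iInf fun hG => ?_
    rw [ENNReal.ofReal_div_of_pos hn0, ENNReal.ofReal_natCast, rootedResistance]
    refine ENNReal.div_le_div_right ?_ _
    by_cases h : ∑ x, G.resistance ρ x = ⊤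
    · rw [h]; exact le_top
    · exact ENNReal.ofReal_le_of_le_toReal (minRooted_le (HasRooted.of_graph G ρ le_rfl h) hG)

/-- The limit of `minRooted α n / n`, which by Fekete's lemma is the infimum over `n ≥ 1`. -/
noncomputable def rootedLimit (α : ℝ) (hα : 2 ≤ α) : ℝ := (subadditive_minRooted hα).lim

theorem bddBelow_minRooted_div (α : ℝ) :
    BddBelow (Set.range fun n : ℕ => minRooted α n / n) :=
  ⟨0, by rintro _ ⟨n, rfl⟩; exact div_nonneg (minRooted_nonneg _ _) n.cast_nonneg⟩

theorem tendsto_minRooted {α : ℝ} (hα : 2 ≤ α) :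
    Tendsto (fun n : ℕ => minRooted α n / n) atTop (𝓝 (rootedLimit α hα)) :=
  (subadditive_minRooted hα).tendsto_lim (bddBelow_minRooted_div α)

theorem rootedLimit_le_div {α : ℝ} (hα : 2 ≤ α) {n : ℕ} (hn : n ≠ 0) :
    rootedLimit α hα ≤ minRooted α n / n :=
  (subadditive_minRooted hα).lim_le_div (bddBelow_minRooted_div α) hn

theorem tendsto_optRootedResistance {α : ℝ} (hα : 2 ≤ α) :
    Tendsto (optRootedResistance α) atTop (𝓝 (ENNReal.ofReal (rootedLimit α hα))) := by
  refine (ENNReal.tendsto_ofReal (tendsto_minRooted hα)).congr' ?_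
  filter_upwards [eventually_ne_atTop 0] with n hn
  exact (optRootedResistance_eq hα hn).symm

/-- Copies of a block with `N` vertices and `m > N` edges, glued to a star, interpolate between the
star at `α = 2` and the block at `α = 2 m / N`. -/
theorem rootedLimit_le_of_block {N m : ℕ} {T : ℝ} (h : HasRooted N m T) (hN : 0 < N) (hm : N < m)
    (hT : T ≤ N) {α : ℝ} (hα : 2 ≤ α) (hα' : α ≤ 2 * m / N) :
    rootedLimit α hα ≤ 1 - (α - 2) * ((N - T) / (2 * (m - N))) := by
  have hN0 : (0 : ℝ) < N := by exact_mod_cast hN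
  have hm0 : (0 : ℝ) < (m : ℝ) - N := sub_pos.2 (by exact_mod_cast hm)
  set θ : ℝ := (α - 2) / (2 * (m - N)) with hθ
  have hθ0 : 0 ≤ θ := div_nonneg (by linarith) (by linarith)
  have hθm : θ * (2 * (m - N)) = α - 2 := div_mul_cancel₀ _ (by linarith)
  have hθN : θ * N ≤ 1 := by
    rw [le_div_iff₀ hN0] at hα'
    rw [hθ, div_mul_eq_mul_div, div_le_one (by linarith)]
    linarith
  have key : ∀ n : ℕ, n ≠ 0 → minRooted α n / n ≤ 1 - (θ - 1 / n) * (N - T) := by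
    intro n hn
    have hn0 : (0 : ℝ) < n := by positivity
    set k := ⌊θ * n⌋₊ with hk
    have hk1 : (k : ℝ) ≤ θ * n := Nat.floor_le (by positivity)
    have hk2 : θ * n < k + 1 := Nat.lt_floor_add_one _
    have hkn : k * N ≤ n := by
      have : (k : ℝ) * N ≤ n := by nlinarith
      exact_mod_cast this
    have h1 := (h.mul k).add (HasRooted.star (n - k * N))
    rw [Nat.add_sub_cancel' hkn] at h1
    have h2 := minRooted_le (α := α) h1 (by
      push_cast [Nat.cast_sub hkn]
      nlinarith)
    rw [div_le_iff₀ hn0]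
    push_cast [Nat.cast_sub hkn] at h2
    have : (1 - (θ - 1 / n) * (N - T)) * n = n - (θ * n - 1) * (N - T) := by
      field_simp
    rw [this]
    nlinarith
  have hlim : Tendsto (fun n : ℕ => 1 - (θ - 1 / (n : ℝ)) * (N - T)) atTop
      (𝓝 (1 - (θ - 0) * (N - T))) :=
    ((tendsto_const_nhds.sub tendsto_one_div_atTop_nhds_zero_nat).mul_const _).const_sub _
  have := le_of_tendsto_of_tendsto (tendsto_minRooted hα) hlim (by
    filter_upwards [eventually_ne_atTop 0] with n hn using key n hn)
  refine this.trans_eq ?_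
  rw [hθ]; ring

/-! ### From rooted to unrooted networks and back: Green kernels -/

namespace HasRooted

/-- If `g_x` is the potential of a unit current from `x` to the root that vanishes at the root, then
the resistance between `x` and `y` is `g_x(x) + g_y(y) - 2 g_x(y)`; the last terms add up to the
energy of the potential `∑ g_x`, which is nonnegative. -/
theorem exists_sum_resistance_le {n m : ℕ} {T : ℝ} (h : HasRooted n m T) :
    ∃ G : Multigraph (Fin (n + 1)), G.numEdges ≤ m ∧
      ∑ x, ∑ y, G.resistance x y ≤ ENNReal.ofReal (2 * (n + 1) * T) := by
  obtain ⟨G, ρ, r, hm, hr, h, hs⟩ := h.exists_graph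
  refine ⟨G, hm, ?_⟩
  have hex : ∀ x, ∃ φ, G.IsUnitPotential x ρ φ ∧ φ ρ = 0 ∧ φ x ≤ r x := fun x => by
    obtain ⟨φ, hφ, hle⟩ := exists_isUnitPotential_le (hr x) (h x)
    exact ⟨_, hφ.sub_const (φ ρ), sub_self _, hle⟩
  choose g hg hgρ hgr using hex
  have hR : ∀ x y, G.resistance x y =
      ENNReal.ofReal (g x x + g y y - g x y - g y x) := fun x y => by
    rw [resistance_eq ((hg x).sub (hg y))]
    congr 1
    simp only [Pi.sub_apply]; ring
  have hnn : ∀ x y, 0 ≤ g x x + g y y - g x y - g y x := fun x y => by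
    have := ((hg x).sub (hg y)).drop_nonneg
    simp only [Pi.sub_apply] at this
    linarith
  simp only [hR]
  have h1 : ∀ x, ∑ y, ENNReal.ofReal (g x x + g y y - g x y - g y x) =
      ENNReal.ofReal (∑ y, (g x x + g y y - g x y - g y x)) := fun x =>
    (ENNReal.ofReal_sum_of_nonneg fun y _ => hnn x y).symm
  simp only [h1]
  rw [← ENNReal.ofReal_sum_of_nonneg fun x _ => Finset.sum_nonneg fun y _ => hnn x y]
  refine ENNReal.ofReal_le_ofReal ?_
  have h2 : G.energy (∑ x, g x) (∑ y, g y) = ∑ x, ∑ y, g x y := by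
    rw [energy_sum_left]
    refine Finset.sum_congr rfl fun x _ => ?_
    rw [energy_sum_right]
    refine Finset.sum_congr rfl fun y _ => ?_
    rw [(hg y).energy_eq, hgρ, sub_zero]
  have h3 : 0 ≤ ∑ x, ∑ y, g x y := h2 ▸ G.energy_self_nonneg _
  have h4 : ∑ x, ∑ y, g y x = ∑ x, ∑ y, g x y := Finset.sum_comm
  have h5 : ∑ x, g x x ≤ T := (Finset.sum_le_sum fun x _ => hgr x).trans hs
  simp only [Finset.sum_sub_distrib, Finset.sum_add_distrib, Finset.sum_const, Finset.card_univ,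
    Fintype.card_fin, nsmul_eq_mul, h4, ← Finset.mul_sum]
  push_cast
  nlinarith

end HasRooted

namespace Multigraph

variable {V : Type*} [Fintype V] [DecidableEq V]

/-- `g` is the Green kernel of the network `G` grounded at `S`: `g x` is the potential of a unit
current that enters at `x` and leaves through `S`. Equivalently, `g` is the reproducing kernel of
the space of functions that vanish on `S`, with the Dirichlet form as inner product. -/
structure IsGreen (G : Multigraph V) (S : Finset V) (g : V → V → ℝ) : Prop where
  vanish : ∀ x, ∀ v ∈ S, g x v = 0
  energy_eq : ∀ x f, (∀ v ∈ S, f v = 0) → G.energy f (g x) = f x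

namespace IsGreen

variable {G : Multigraph V} {S : Finset V} {g : V → V → ℝ}

theorem symm (h : G.IsGreen S g) (x y : V) : g x y = g y x := by
  rw [← h.energy_eq y (g x) (h.vanish x), energy_comm, h.energy_eq x (g y) (h.vanish y)]

theorem diag_nonneg (h : G.IsGreen S g) (x : V) : 0 ≤ g x x := by
  rw [← h.energy_eq x (g x) (h.vanish x)]
  exact G.energy_self_nonneg _

theorem sq_le (h : G.IsGreen S g) (x : V) {f : V → ℝ} (hf : ∀ v ∈ S, f v = 0) :
    f x ^ 2 ≤ g x x * G.energy f f := by
  have := G.energy_sq_le f (g x)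
  rwa [h.energy_eq x f hf, h.energy_eq x (g x) (h.vanish x), mul_comm] at this

theorem apply_eq_zero (h : G.IsGreen S g) {v : V} (hv : g v v = 0) (x : V) : g x v = 0 := by
  have := h.sq_le v (h.vanish x)
  rw [hv, zero_mul] at this
  exact pow_eq_zero_iff two_ne_zero |>.1 (le_antisymm this (sq_nonneg _))

/-- Grounding one more vertex `v` subtracts the rank one kernel `g_v g_vᵀ / g_v(v)`. For
`g v v = 0` the potential at `v` vanishes anyway, and nothing is subtracted. -/
theorem insert (h : G.IsGreen S g) (v : V) :
    G.IsGreen (insert v S) (fun x => g x - (g x v / g v v) • g v) where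
  vanish x w hw := by
    simp only [Pi.sub_apply, Pi.smul_apply, smul_eq_mul]
    rcases Finset.mem_insert.1 hw with rfl | hw
    · by_cases h0 : g w w = 0
      · simp [h0, h.apply_eq_zero h0]
      · rw [div_mul_cancel₀ _ h0, sub_self]
    · simp [h.vanish _ w hw]
  energy_eq x f hf := by
    have hf' : ∀ w ∈ S, f w = 0 := fun w hw => hf w (Finset.mem_insert_of_mem hw)
    rw [energy_sub_right, energy_smul_right, h.energy_eq x f hf', h.energy_eq v f hf',
      hf v (Finset.mem_insert_self _ _)]
    ring

/-- The drop from `x` to `y` of the kernel is at most the effective resistance: contracting `S`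
does not increase resistances. -/
theorem drop_le (h : G.IsGreen S g) {x y : V} (hR : G.resistance x y ≠ ⊤) :
    g x x + g y y - 2 * g x y ≤ (G.resistance x y).toReal := by
  have h1 := sq_sub_le_of_resistance hR (g x - g y)
  have hv : ∀ v ∈ S, (g x - g y) v = 0 := fun v hv => by
    simp [h.vanish x v hv, h.vanish y v hv]
  have h2 : G.energy (g x - g y) (g x - g y) = g x x + g y y - 2 * g x y := by
    rw [energy_sub_right, h.energy_eq x _ hv, h.energy_eq y _ hv]
    simp only [Pi.sub_apply]
    rw [h.symm y x]; ring
  have h3 := G.energy_self_nonneg (g x - g y)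
  have h4 : (g x - g y) x - (g x - g y) y = g x x + g y y - 2 * g x y := by
    simp only [Pi.sub_apply]
    rw [h.symm y x]; ring
  rw [h4, h2] at h1
  rw [h2] at h3
  by_contra! hlt
  nlinarith [ENNReal.toReal_nonneg (a := G.resistance x y)]

/-- The trace identity `2 N tr g = ∑ (g_x(x) + g_y(y) - 2 g_x(y)) + 2 ∑ g_x(y)`, with the last sum
bounded by `N` times the Frobenius norm of `g`. -/
theorem trace_le (h : G.IsGreen S g) (hR : ∀ x y, G.resistance x y ≠ ⊤) {F : ℝ} (hF : 0 ≤ F)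
    (hg : ∑ x, ∑ y, g x y ^ 2 ≤ F ^ 2) :
    2 * Fintype.card V * ∑ x, g x x ≤
      ∑ x, ∑ y, (G.resistance x y).toReal + 2 * (Fintype.card V * F) := by
  have h1 : ∑ x, ∑ y, (g x x + g y y - 2 * g x y) ≤ ∑ x, ∑ y, (G.resistance x y).toReal :=
    Finset.sum_le_sum fun x _ => Finset.sum_le_sum fun y _ => h.drop_le (hR x y)
  have h2 : ∑ x, ∑ y, g x y ≤ Fintype.card V * F := by
    refine le_of_sq_le_sq ?_ (by positivity)
    have := sq_sum_le_card_mul_sum_sq (s := (Finset.univ : Finset (V × V)))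
      (f := fun p => g p.1 p.2)
    rw [Fintype.sum_prod_type, Fintype.sum_prod_type, Finset.card_univ, Fintype.card_prod] at this
    push_cast at this
    nlinarith [mul_self_nonneg (Fintype.card V : ℝ)]
  simp only [Finset.sum_sub_distrib, Finset.sum_add_distrib, Finset.sum_const, Finset.card_univ,
    nsmul_eq_mul, ← Finset.mul_sum] at h1
  linarith

end IsGreen

theorem exists_isGreen_singleton (G : Multigraph V) (ρ : V) (h : ∀ x, G.resistance x ρ ≠ ⊤) :
    ∃ g, G.IsGreen {ρ} g ∧ ∀ x, g x x = (G.resistance x ρ).toReal := by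
  have hex : ∀ x, ∃ φ, G.IsUnitPotential x ρ φ ∧ φ ρ = 0 := fun x => by
    obtain ⟨φ, hφ⟩ := exists_isUnitPotential_of_resistance_ne_top (h x)
    exact ⟨_, hφ.sub_const (φ ρ), sub_self _⟩
  choose g hg hgρ using hex
  refine ⟨g, ⟨fun x v hv => ?_, fun x f hf => ?_⟩, fun x => ?_⟩
  · rw [Finset.mem_singleton.1 hv, hgρ]
  · rw [(hg x).energy_eq, hf ρ (Finset.mem_singleton_self _), sub_zero]
  · rw [resistance_eq (hg x), ENNReal.toReal_ofReal (hg x).drop_nonneg, hgρ, sub_zero]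

/-- Ground further vertices as long as this lowers the trace by more than `T / s`. This stops before
the `s`-th further vertex, and then every column of the kernel is small. -/
theorem exists_isGreen_frobenius_le {G : Multigraph V} {S₀ : Finset V} {g₀ : V → V → ℝ}
    (h₀ : G.IsGreen S₀ g₀) {T : ℝ} (hT : ∑ x, g₀ x x ≤ T) {s : ℕ} (hs : 0 < s) :
    ∃ S g, G.IsGreen S g ∧ S₀ ⊆ S ∧ S.card ≤ S₀.card + s ∧
      ∑ x, ∑ y, g x y ^ 2 ≤ T ^ 2 / s := by
  by_contra! hne
  have hs0 : (0 : ℝ) < s := by exact_mod_cast hs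
  have hT0 : 0 ≤ T := (Finset.sum_nonneg fun x _ => h₀.diag_nonneg x).trans hT
  have key : ∀ k ≤ s, ∃ S g, G.IsGreen S g ∧ S₀ ⊆ S ∧ S.card ≤ S₀.card + k ∧
      ∑ x, g x x ≤ T - k * (T / s) ∧ (k ≠ 0 → ∑ x, g x x < T - k * (T / s)) := by
    intro k hk
    induction k with
    | zero => exact ⟨S₀, g₀, h₀, subset_rfl, le_rfl, by simpa using hT, by simp⟩
    | succ k ih =>
      obtain ⟨S, g, hg, hS, hc, ht, -⟩ := ih (by omega)
      have hbad := hne S g hg hS (by omega)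
      have htr : ∑ x, g x x ≤ T := ht.trans (by
        have : 0 ≤ k * (T / s) := by positivity
        linarith)
      obtain ⟨v, hv⟩ : ∃ v, T / s * g v v < ∑ y, g v y ^ 2 := by
        by_contra! hall
        have := Finset.sum_le_sum fun v (_ : v ∈ Finset.univ) => hall v
        rw [← Finset.mul_sum] at this
        have h1 : T / s * ∑ x, g x x ≤ T / s * T := by gcongr
        have h2 : T / s * T = T ^ 2 / s := by ring
        linarith
      have hv0 : 0 < g v v := by
        refine (hg.diag_nonneg v).lt_of_ne' fun h0 => ?_
        have : ∀ y, g v y = 0 := fun y => by rw [hg.symm, hg.apply_eq_zero h0]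
        simp [h0, this] at hv
      have htr' : ∑ x, (g x - (g x v / g v v) • g v) x = ∑ x, g x x - (∑ y, g v y ^ 2) / g v v := by
        simp only [Pi.sub_apply, Pi.smul_apply, smul_eq_mul, Finset.sum_sub_distrib, Finset.sum_div]
        congr 1
        refine Finset.sum_congr rfl fun x _ => ?_
        rw [hg.symm x v]; ring
      have hdrop : T / s < (∑ y, g v y ^ 2) / g v v := (lt_div_iff₀ hv0).2 hv
      have hlt : ∑ x, (g x - (g x v / g v v) • g v) x < T - ((k + 1 : ℕ) : ℝ) * (T / s) := by
        rw [htr']; push_cast; linarith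
      exact ⟨Insert.insert v S, _, hg.insert v, hS.trans (Finset.subset_insert _ _),
        (Finset.card_insert_le _ _).trans (by omega), hlt.le, fun _ => hlt⟩
  obtain ⟨S, g, hg, -, -, -, hlt⟩ := key s le_rfl
  have h1 := hlt hs.ne'
  rw [mul_div_cancel₀ _ hs0.ne', sub_self] at h1
  exact absurd h1 (not_lt.2 (Finset.sum_nonneg fun x _ => hg.diag_nonneg x))

/-- The grounded set is contracted to the root. -/
theorem IsGreen.hasRooted {G : Multigraph V} {S : Finset V} {g : V → V → ℝ} (h : G.IsGreen S g)
    {T : ℝ} (hT : ∑ x, g x x ≤ T) : HasRooted (Fintype.card V - S.card) G.numEdges T := by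
  obtain ⟨s, t, hst⟩ := G.exists_edges
  let p : V → Option {x // x ∉ S} := fun x => if hx : x ∈ S then none else some ⟨x, hx⟩
  refine HasRooted.of_family (fun e => p (s e)) (fun e => p (t e)) (fun x => g x x)
    (fun x => h.diag_nonneg x) (fun x φ => ?_) (by simp) (by simp) ?_
  · have h1 := h.sq_le x (f := fun v => φ (p v) - φ none) (fun v hv => by simp [p, hv])
    simp only [hst, sub_sub_sub_cancel_right, ← sq] at h1
    simpa [p, x.2] using h1
  · refine le_trans ?_ hT
    rw [← Finset.sum_subtype (s := Sᶜ) (by simp) (fun x => g x x)]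
    exact Finset.sum_le_sum_of_subset_of_nonneg (Finset.subset_univ _)
      fun x _ _ => h.diag_nonneg x

/-- An unrooted network yields a rooted one whose average resistance is, up to a lower order error,
at most half as large. -/
theorem exists_hasRooted {n : ℕ} (hn : 0 < n) (G : Multigraph (Fin n))
    (hR : ∀ x y, G.resistance x y ≠ ⊤) {s : ℕ} (hs : 0 < s) :
    ∃ k, k ≤ n ∧ k ≤ s + 1 ∧ HasRooted (n - k) G.numEdges
      ((∑ x, ∑ y, (G.resistance x y).toReal) / n * (1 / 2 + 1 / √s)) := by
  set T := ∑ x, ∑ y, (G.resistance x y).toReal with hTdef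
  have hn0 : (0 : ℝ) < n := by exact_mod_cast hn
  have hs0 : (0 : ℝ) < s := by exact_mod_cast hs
  have hT0 : 0 ≤ T := Finset.sum_nonneg fun x _ => Finset.sum_nonneg fun y _ =>
    ENNReal.toReal_nonneg
  obtain ⟨ρ, -, hρ⟩ : ∃ ρ ∈ Finset.univ, ∑ x, (G.resistance x ρ).toReal ≤ T / n := by
    have : Nonempty (Fin n) := ⟨⟨0, hn⟩⟩
    refine Finset.exists_le_of_sum_le (s := Finset.univ) Finset.univ_nonempty ?_
    rw [Finset.sum_comm, Finset.sum_const, Finset.card_univ, Fintype.card_fin, nsmul_eq_mul,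
      mul_div_cancel₀ _ hn0.ne']
  obtain ⟨g₀, hg₀, hdiag⟩ := G.exists_isGreen_singleton ρ fun x => hR x ρ
  obtain ⟨S, g, hg, -, hc, hF⟩ := exists_isGreen_frobenius_le hg₀ (T := T / n)
    (by simpa only [hdiag] using hρ) hs
  refine ⟨S.card, by simpa using S.card_le_univ, by simpa [add_comm] using hc, ?_⟩
  have htr : ∑ x, g x x ≤ T / n * (1 / 2 + 1 / √s) := by
    have := hg.trace_le hR (F := T / n / √s) (by positivity) (by
      rwa [div_pow _ (√(s : ℝ)), Real.sq_sqrt hs0.le])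
    rw [Fintype.card_fin, ← hTdef] at this
    have h2 : 2 * n * (T / n * (1 / 2 + 1 / √s)) = T + 2 * (n * (T / n / √s)) := by
      field_simp
    rw [← h2] at this
    exact le_of_mul_le_mul_left this (by positivity)
  simpa using hg.hasRooted htr

end Multigraph

/-! ### A group in which no short reduced word in five involutions is trivial -/

/-- The reduced words of length at most `L` in five letters. -/
abbrev WordBall (L : ℕ) : Type := {w : List (Fin 5) // w.IsChain (· ≠ ·) ∧ w.length ≤ L}

noncomputable instance (L : ℕ) : Fintype (WordBall L) :=
  haveI : Finite (WordBall L) :=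
    ((List.finite_length_le (Fin 5) L).subset fun _ h => h.2).to_subtype
  Fintype.ofFinite _

/-- Multiplication of a reduced word by the letter `e` from the left: cancel `e` if the word starts
with it, and otherwise prepend it, unless the word is too long. -/
def flipLetter {L : ℕ} (e : Fin 5) (w : WordBall L) : WordBall L :=
  if h : w.1.head? = some e then ⟨w.1.tail, w.2.1.tail, by
    rw [List.length_tail]; exact (Nat.sub_le _ _).trans w.2.2⟩
  else if hl : w.1.length < L then ⟨e :: w.1, by
    refine List.isChain_cons.2 ⟨fun y hy hey => h (by rw [hey]; exact hy), w.2.1⟩, hl⟩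
  else w

theorem flipLetter_involutive {L : ℕ} (e : Fin 5) :
    Function.Involutive (flipLetter (L := L) e) := by
  rintro ⟨w, hw, hl⟩
  apply Subtype.ext
  cases w with
  | nil =>
    by_cases h0 : 0 < L <;> simp [flipLetter, h0]
  | cons f w =>
    have hl' : w.length < L := hl
    by_cases hfe : f = e
    · subst hfe
      have : w.head? ≠ some f := fun h => (List.isChain_cons.1 hw).1 f h rfl
      simp [flipLetter, this, hl']
    · by_cases hlt : w.length + 1 < L <;> simp [flipLetter, hfe, hlt]

/-- The permutation of the ball of reduced words given by the letter `e`. -/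
def letterPerm (L : ℕ) (e : Fin 5) : Equiv.Perm (WordBall L) :=
  (flipLetter_involutive e).toPerm

theorem letterPerm_mul_self (L : ℕ) (e : Fin 5) : letterPerm L e * letterPerm L e = 1 :=
  Equiv.ext fun w => flipLetter_involutive e w

theorem letterPerm_prod_apply {L : ℕ} (w : List (Fin 5)) (hw : w.IsChain (· ≠ ·))
    (hl : w.length ≤ L) :
    ((w.map (letterPerm L)).prod ⟨[], List.IsChain.nil, Nat.zero_le _⟩).1 = w := by
  induction w with
  | nil => rfl
  | cons e w ih =>
    have hw' := List.isChain_cons.1 hw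
    have hl' : w.length < L := hl
    have ih := ih hw'.2 hl'.le
    rw [List.map_cons, List.prod_cons, Equiv.Perm.mul_apply]
    set v := (w.map (letterPerm L)).prod ⟨[], List.IsChain.nil, Nat.zero_le _⟩ with hv
    have h1 : v.1.head? ≠ some e := fun h => hw'.1 e (by rw [ih] at h; exact h) rfl
    have h2 : v.1.length < L := by rw [ih]; exact hl'
    change (flipLetter e v).1 = e :: w
    rw [flipLetter, dif_neg h1, dif_pos h2]
    exact congrArg _ ih

/-! ### The base graph and its covers -/

/-- The first end of an edge of the base graph. The base graph has the vertices `0`, of degree 4,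
and `1`, `2`, of degree 3; two edges join `0` to `1`, two join `0` to `2`, and one joins `1`
to `2`. -/
def baseSrc : Fin 5 → Fin 3 := ![0, 0, 0, 0, 1]

/-- The second end of an edge of the base graph. -/
def baseTgt : Fin 5 → Fin 3 := ![1, 1, 2, 2, 2]

/-- The edge `e` is incident with the vertex `v` of the base graph. -/
def BaseInc (v : Fin 3) (e : Fin 5) : Prop := baseSrc e = v ∨ baseTgt e = v

instance (v : Fin 3) (e : Fin 5) : Decidable (BaseInc v e) := inferInstanceAs (Decidable (_ ∨ _))

/-- The other end of the edge `e` at the vertex `v` of the base graph. -/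
def baseOpp (v : Fin 3) (e : Fin 5) : Fin 3 := if baseSrc e = v then baseTgt e else baseSrc e

/-- The `ZMod M` component of the voltage: only the edge `0` shifts it. -/
def baseShift (M : ℕ) (e : Fin 5) : ZMod M := if e = 0 then 1 else 0

/-- The vertices of the cover of the base graph with voltages in `Perm (WordBall L) × ZMod M`. -/
abbrev Cover (L M : ℕ) : Type := Fin 3 × Equiv.Perm (WordBall L) × ZMod M

namespace Cover

variable {L M : ℕ}

/-- The vertex reached from `v` through the lift of the edge `e` of the base graph. -/
def step (e : Fin 5) (v : Cover L M) : Cover L M :=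
  (baseOpp v.1 e, letterPerm L e * v.2.1,
    if baseSrc e = v.1 then v.2.2 + baseShift M e else v.2.2 - baseShift M e)

theorem step_fst (e : Fin 5) (v : Cover L M) : (step e v).1 = baseOpp v.1 e := rfl

/-- The end of the walk from `x` that passes through lifts of the edges in the list `w`. The last
step of the walk is the head of the list. -/
def run (x : Cover L M) (w : List (Fin 5)) : Cover L M := w.foldr step x

@[simp] theorem run_nil (x : Cover L M) : run x [] = x := rfl

@[simp] theorem run_cons (x : Cover L M) (e : Fin 5) (w : List (Fin 5)) :
    run x (e :: w) = step e (run x w) := rfl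

/-- The edges by which the walk `w` from `x` can be continued without backtracking. -/
def next (x : Cover L M) (w : List (Fin 5)) : Finset (Fin 5) :=
  Finset.univ.filter fun e => BaseInc (run x w).1 e ∧ w.head? ≠ some e

theorem mem_next {x : Cover L M} {w : List (Fin 5)} {e : Fin 5} :
    e ∈ next x w ↔ BaseInc (run x w).1 e ∧ w.head? ≠ some e := by simp [next]

/-- `w` describes a walk from `x` without backtracking. -/
def IsWalk (x : Cover L M) : List (Fin 5) → Prop
  | [] => True
  | e :: w => IsWalk x w ∧ e ∈ next x w

theorem IsWalk.isChain {x : Cover L M} {w : List (Fin 5)} (h : IsWalk x w) :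
    w.IsChain (· ≠ ·) := by
  induction w with
  | nil => exact List.IsChain.nil
  | cons e w ih =>
    exact List.isChain_cons.2 ⟨fun y hy hey => (mem_next.1 h.2).2 (by rw [hey]; exact hy), ih h.1⟩

theorem run_perm (x : Cover L M) (w : List (Fin 5)) :
    (run x w).2.1 = (w.map (letterPerm L)).prod * x.2.1 := by
  induction w with
  | nil => simp
  | cons e w ih => simp [step, ih, mul_assoc]

/-- Short walks without backtracking from `x` have different ends: the cover looks like a tree. -/
theorem eq_of_run_perm_eq {x : Cover L M} {w w' : List (Fin 5)} (hw : w.IsChain (· ≠ ·))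
    (hw' : w'.IsChain (· ≠ ·)) (hl : w.length ≤ L) (hl' : w'.length ≤ L)
    (h : (run x w).2.1 = (run x w').2.1) : w = w' := by
  rw [run_perm, run_perm, mul_left_inj] at h
  rw [← letterPerm_prod_apply w hw hl, h, letterPerm_prod_apply w' hw' hl']

/-- The walks without backtracking that continue `w` by at most `k` steps. -/
def extensions (x : Cover L M) : ℕ → List (Fin 5) → Finset (List (Fin 5))
  | 0, w => {w}
  | k + 1, w => insert w ((next x w).biUnion fun e => extensions x k (e :: w))

theorem suffix_of_mem_extensions {x : Cover L M} {k : ℕ} {w w' : List (Fin 5)}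
    (h : w' ∈ extensions x k w) : w <:+ w' ∧ w'.length ≤ w.length + k := by
  induction k generalizing w with
  | zero => rw [Finset.mem_singleton.1 h]; simp
  | succ k ih =>
    rcases Finset.mem_insert.1 h with rfl | h
    · simp
    · obtain ⟨e, -, h⟩ := Finset.mem_biUnion.1 h
      obtain ⟨h1, h2⟩ := ih h
      exact ⟨(List.suffix_cons e w).trans h1, by simp at h2; omega⟩

theorem isWalk_of_mem_extensions {x : Cover L M} {k : ℕ} {w w' : List (Fin 5)} (hw : IsWalk x w)
    (h : w' ∈ extensions x k w) : IsWalk x w' := by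
  induction k generalizing w with
  | zero => rwa [Finset.mem_singleton.1 h]
  | succ k ih =>
    rcases Finset.mem_insert.1 h with rfl | h
    · exact hw
    · obtain ⟨e, he, h⟩ := Finset.mem_biUnion.1 h
      exact ih (w := e :: w) ⟨hw, he⟩ h

/-- The energy of the potential `u` in the last step of a walk. -/
def lastEnergy (u : Cover L M → ℝ) (x : Cover L M) : List (Fin 5) → ℝ
  | [] => 0
  | e :: w => (u (run x (e :: w)) - u (run x w)) ^ 2

/-- The energy of the potential `u` in the edge from `v` to the root, where `u` is `0`. The vertices
joined to the root are those over `0` with `ZMod M` component `0`. -/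
def rootEnergy (u : Cover L M → ℝ) (v : Cover L M) : ℝ :=
  if v.1 = 0 ∧ v.2.2 = 0 then u v ^ 2 else 0

/-- The energy of the potential `u` in the tree of the extensions of the walk `w` by at most `k`
steps, including the edges to the root. -/
def treeEnergy (u : Cover L M → ℝ) (x : Cover L M) : ℕ → List (Fin 5) → ℝ
  | 0, w => rootEnergy u (run x w)
  | k + 1, w => rootEnergy u (run x w) +
      ∑ e ∈ next x w, ((u (run x (e :: w)) - u (run x w)) ^ 2 + treeEnergy u x k (e :: w))

theorem treeEnergy_eq_sum (u : Cover L M → ℝ) (x : Cover L M) (k : ℕ) (w : List (Fin 5)) :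
    lastEnergy u x w + treeEnergy u x k w =
      ∑ w' ∈ extensions x k w, (lastEnergy u x w' + rootEnergy u (run x w')) := by
  induction k generalizing w with
  | zero => simp [extensions, treeEnergy]
  | succ k ih =>
    have hnot : w ∉ (next x w).biUnion fun e => extensions x k (e :: w) := fun h => by
      obtain ⟨e, -, h⟩ := Finset.mem_biUnion.1 h
      have := (suffix_of_mem_extensions h).1.length_le
      simp at this
    have hdisj : ((next x w : Finset (Fin 5)) : Set (Fin 5)).PairwiseDisjoint
        fun e => extensions x k (e :: w) := by
      intro e _ f _ hef
      refine Finset.disjoint_left.2 fun w' h1 h2 => hef ?_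
      have := (List.suffix_of_suffix_length_le (suffix_of_mem_extensions h1).1
        (suffix_of_mem_extensions h2).1 (by simp)).eq_of_length (by simp)
      exact (List.cons.inj this).1
    rw [extensions, Finset.sum_insert hnot, Finset.sum_biUnion hdisj, treeEnergy, ← add_assoc]
    congr 1
    exact Finset.sum_congr rfl fun e _ => ih (e :: w)

theorem rootEnergy_nonneg (u : Cover L M → ℝ) (v : Cover L M) : 0 ≤ rootEnergy u v := by
  unfold rootEnergy; split_ifs <;> positivity

theorem treeEnergy_nonneg (u : Cover L M → ℝ) (x : Cover L M) (k : ℕ) (w : List (Fin 5)) :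
    0 ≤ treeEnergy u x k w := by
  induction k generalizing w with
  | zero => exact rootEnergy_nonneg _ _
  | succ k ih =>
    exact add_nonneg (rootEnergy_nonneg _ _)
      (Finset.sum_nonneg fun e _ => add_nonneg (sq_nonneg _) (ih _))

theorem rootEnergy_le_treeEnergy (u : Cover L M → ℝ) (x : Cover L M) (k : ℕ) (w : List (Fin 5)) :
    rootEnergy u (run x w) ≤ treeEnergy u x k w := by
  cases k with
  | zero => exact le_rfl
  | succ k =>
    exact le_add_of_nonneg_right
      (Finset.sum_nonneg fun e _ => add_nonneg (sq_nonneg _) (treeEnergy_nonneg _ _ _ _))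

/-! ### Every branch of the tree meets an edge to the root -/

/-- The tree of the extensions of the walk `w` by `j` or more steps has conductance at least
`1 / (j + 1)` to the root, as is the case if some extension by at most `j` steps ends at a vertex
joined to the root. -/
def Grounded (u : Cover L M → ℝ) (x : Cover L M) (j : ℕ) (w : List (Fin 5)) : Prop :=
  ∀ k, j ≤ k → u (run x w) ^ 2 ≤ (1 + j) * treeEnergy u x k w

variable {u : Cover L M → ℝ} {x : Cover L M} {w : List (Fin 5)}

theorem Grounded.mono {i j : ℕ} (h : Grounded u x i w) (hij : i ≤ j) : Grounded u x j w :=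
  fun k hk => (h k (hij.trans hk)).trans <| by
    have : (i : ℝ) ≤ j := by exact_mod_cast hij
    gcongr
    exact treeEnergy_nonneg _ _ _ _

theorem Grounded.of_cons {j : ℕ} {e : Fin 5} (he : e ∈ next x w) (h : Grounded u x j (e :: w)) :
    Grounded u x (j + 1) w := by
  intro k hk
  obtain ⟨k, rfl⟩ : ∃ k', k = k' + 1 := ⟨k - 1, by omega⟩
  have h1 := h k (by omega)
  have h2 : (u (run x (e :: w)) - u (run x w)) ^ 2 + treeEnergy u x k (e :: w) ≤
      treeEnergy u x (k + 1) w := by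
    have := Finset.single_le_sum (f := fun e => (u (run x (e :: w)) - u (run x w)) ^ 2 +
      treeEnergy u x k (e :: w))
      (fun e _ => add_nonneg (sq_nonneg _) (treeEnergy_nonneg _ _ _ _)) he
    exact this.trans (le_add_of_nonneg_left (rootEnergy_nonneg _ _))
  set a := u (run x (e :: w))
  set b := u (run x w)
  have hc : (0 : ℝ) < 1 + j := by positivity
  refine le_trans ?_ (mul_le_mul_of_nonneg_left h2 (by positivity))
  push_cast
  have h3 : b ^ 2 ≤ (1 + (j + 1)) * ((a - b) ^ 2 + a ^ 2 / (1 + j)) := by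
    rw [← sub_nonneg]
    have : (1 + ((j : ℝ) + 1)) * ((a - b) ^ 2 + a ^ 2 / (1 + j)) - b ^ 2 =
        ((1 + j) * (a - b) + a) ^ 2 / (1 + j) := by
      field_simp
      ring
    rw [this]
    positivity
  have h4 : a ^ 2 / (1 + j) ≤ treeEnergy u x k (e :: w) := by
    rw [div_le_iff₀ hc]; linarith
  refine h3.trans ?_
  gcongr

theorem grounded_of_add_eq_zero (n : ℕ) (w : List (Fin 5)) (hv : (run x w).1 = 0)
    (hw : w.head? ≠ some 0) (h : (run x w).2.2 + n = 0) : Grounded u x (2 * n) w := by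
  induction n generalizing w with
  | zero =>
    intro k _
    have h0 : (run x w).2.2 = 0 := by simpa using h
    have := rootEnergy_le_treeEnergy u x k w
    rw [rootEnergy, if_pos ⟨hv, h0⟩] at this
    simpa using this
  | succ n ih =>
    have h0 : (0 : Fin 5) ∈ next x w := mem_next.2 ⟨by rw [hv]; decide, hw⟩
    have h1 : (1 : Fin 5) ∈ next x (0 :: w) := mem_next.2 ⟨by
      rw [run_cons, step_fst, hv]; decide, by simp⟩
    refine Grounded.of_cons (j := 2 * n + 1) h0 (Grounded.of_cons h1 (ih _ ?_ (by simp) ?_))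
    · rw [run_cons, run_cons, step_fst, step_fst, hv]; decide
    · push_cast at h
      simp only [run_cons, step, hv]
      simp [baseSrc, baseOpp, baseTgt, baseShift]
      linear_combination h

theorem grounded_of_sub_eq_zero (n : ℕ) (w : List (Fin 5)) (hv : (run x w).1 = 0)
    (hw : w.head? ≠ some 1) (h : (run x w).2.2 - n = 0) : Grounded u x (2 * n) w := by
  induction n generalizing w with
  | zero =>
    intro k _
    have h0 : (run x w).2.2 = 0 := by simpa using h
    have := rootEnergy_le_treeEnergy u x k w
    rw [rootEnergy, if_pos ⟨hv, h0⟩] at this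
    simpa using this
  | succ n ih =>
    have h0 : (1 : Fin 5) ∈ next x w := mem_next.2 ⟨by rw [hv]; decide, hw⟩
    have h1 : (0 : Fin 5) ∈ next x (1 :: w) := mem_next.2 ⟨by
      rw [run_cons, step_fst, hv]; decide, by simp⟩
    refine Grounded.of_cons (j := 2 * n + 1) h0 (Grounded.of_cons h1 (ih _ ?_ (by simp) ?_))
    · rw [run_cons, run_cons, step_fst, step_fst, hv]; decide
    · push_cast at h
      simp only [run_cons, step, hv]
      simp [baseSrc, baseOpp, baseTgt, baseShift]
      linear_combination h

theorem grounded_of_fst_eq_zero [NeZero M] (w : List (Fin 5)) (hv : (run x w).1 = 0) :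
    Grounded u x (2 * M) w := by
  by_cases hw : w.head? = some 0
  · refine (grounded_of_sub_eq_zero (run x w).2.2.val w hv (by simp [hw]) (by simp)).mono ?_
    have := (run x w).2.2.val_lt
    omega
  · refine (grounded_of_add_eq_zero (-(run x w).2.2).val w hv hw (by simp)).mono ?_
    have := (-(run x w).2.2).val_lt
    omega

theorem grounded [NeZero M] (w : List (Fin 5)) : Grounded u x (2 * M + 1) w := by
  have key : ∀ e f : Fin 5, e ≠ f → BaseInc (run x w).1 e → BaseInc (run x w).1 f →
      baseOpp (run x w).1 e = 0 → baseOpp (run x w).1 f = 0 → Grounded u x (2 * M + 1) w := by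
    intro e f hef he hf he0 hf0
    by_cases hw : w.head? = some e
    · exact .of_cons (mem_next.2 ⟨hf, by simpa [hw] using hef⟩) (grounded_of_fst_eq_zero _ hf0)
    · exact .of_cons (mem_next.2 ⟨he, hw⟩) (grounded_of_fst_eq_zero _ he0)
  have h3 : ∀ i : Fin 3, i = 0 ∨ i = 1 ∨ i = 2 := by decide
  rcases h3 (run x w).1 with h | h | h
  · exact (grounded_of_fst_eq_zero w h).mono (Nat.le_succ _)
  · exact key 0 1 (by decide) (by rw [h]; decide) (by rw [h]; decide) (by rw [h]; decide)
      (by rw [h]; decide)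
  · exact key 2 3 (by decide) (by rw [h]; decide) (by rw [h]; decide) (by rw [h]; decide)
      (by rw [h]; decide)

end Cover

namespace Cover

variable {L M : ℕ}

/-! ### Convergence of the branch conductances -/

/-- The conductance to infinity, in the universal cover of the base graph, of the branch hanging at
a vertex over `v` that is entered through the edge `e`, without the edge `e` itself. -/
noncomputable def branchCond (v : Fin 3) (e : Fin 5) : ℝ :=
  if v = 0 then (1 + √5) / 2 else if e = 4 then √5 - 1 else 1 / 2 + 3 * √5 / 10

/-- The conductance to infinity of the branch that leaves a vertex over `v` through the edge `e`,
with the edge `e` included. -/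
noncomputable def edgeCond (v : Fin 3) (e : Fin 5) : ℝ :=
  if v = 0 then (1 + √5) / 6 else if e = 4 then 1 - √5 / 5 else (√5 - 1) / 2

/-- The conductance to infinity of a vertex over `v`. -/
noncomputable def vertexCond (v : Fin 3) : ℝ :=
  if v = 0 then 2 * (1 + √5) / 3 else 4 * √5 / 5

theorem two_lt_sqrt_five : 2 < √5 := by
  rw [Real.lt_sqrt] <;> norm_num

theorem sqrt_five_lt : √5 < 2.236068 := by
  rw [Real.sqrt_lt'] <;> norm_num

theorem one_le_branchCond (v : Fin 3) (e : Fin 5) : 1 ≤ branchCond v e := by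
  have := two_lt_sqrt_five
  unfold branchCond; split_ifs <;> linarith

theorem branchCond_le_two (v : Fin 3) (e : Fin 5) : branchCond v e ≤ 2 := by
  have := sqrt_five_lt
  unfold branchCond; split_ifs <;> linarith

/-- An edge in series with a branch. -/
theorem edgeCond_eq {v : Fin 3} {e : Fin 5} (h : BaseInc v e) :
    edgeCond v e * (1 + branchCond (baseOpp v e) e) = branchCond (baseOpp v e) e := by
  have h5 : √5 * √5 = 5 := Real.mul_self_sqrt (by norm_num)
  revert h
  fin_cases v <;> fin_cases e <;>
    simp [BaseInc, baseSrc, baseTgt, baseOpp, edgeCond, branchCond] <;> linarith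

/-- Branches in parallel. -/
theorem sum_edgeCond {v : Fin 3} {e : Fin 5} (h : BaseInc v e) :
    ∑ f with BaseInc v f ∧ e ≠ f, edgeCond v f = branchCond v e := by
  rw [Finset.sum_filter, Fin.sum_univ_five]
  revert h
  fin_cases v <;> fin_cases e <;>
    simp [BaseInc, baseSrc, baseTgt, edgeCond, branchCond] <;> ring

theorem sum_edgeCond_eq_vertexCond (v : Fin 3) :
    ∑ f with BaseInc v f, edgeCond v f = vertexCond v := by
  rw [Finset.sum_filter, Fin.sum_univ_five]
  fin_cases v <;> simp [BaseInc, baseSrc, baseTgt, edgeCond, vertexCond] <;> ring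

variable {u : Cover L M → ℝ} {x : Cover L M}

theorem sum_le_treeEnergy {w : List (Fin 5)} {k : ℕ} {δ : ℝ}
    (hδ : 0 ≤ δ)
    (h : ∀ e ∈ next x w, branchCond (run x (e :: w)).1 e / (1 + δ) * u (run x (e :: w)) ^ 2 ≤
      treeEnergy u x k (e :: w)) :
    ∑ e ∈ next x w, edgeCond (run x w).1 e / (1 + δ / 2) * u (run x w) ^ 2 ≤
      treeEnergy u x (k + 1) w := by
  rw [treeEnergy]
  refine le_add_of_nonneg_of_le (rootEnergy_nonneg _ _) (Finset.sum_le_sum fun e he => ?_)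
  refine le_trans ?_ (add_le_add le_rfl (h e he))
  have hq := edgeCond_eq (mem_next.1 he).1
  have hc := one_le_branchCond (baseOpp (run x w).1 e) e
  rw [run_cons, step_fst]
  set c := branchCond (baseOpp (run x w).1 e) e
  set a := u (step e (run x w))
  set b := u (run x w)
  have hq' : edgeCond (run x w).1 e = c / (1 + c) := by
    rw [eq_div_iff (by linarith), hq]
  have hd : 0 < 1 + δ := by linarith
  -- the edge in series with a conductance `c / (1 + δ)` has conductance `c / (1 + δ + c)`
  have h1 : c / (1 + δ + c) * b ^ 2 ≤ (a - b) ^ 2 + c / (1 + δ) * a ^ 2 := by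
    rw [← sub_nonneg]
    have : (a - b) ^ 2 + c / (1 + δ) * a ^ 2 - c / (1 + δ + c) * b ^ 2 =
        ((1 + δ + c) * a - (1 + δ) * b) ^ 2 / ((1 + δ) * (1 + δ + c)) := by
      field_simp
      ring
    rw [this]
    positivity
  refine le_trans (mul_le_mul_of_nonneg_right ?_ (sq_nonneg b)) h1
  rw [hq', div_div]
  refine div_le_div_of_nonneg_left (by linarith) (by linarith) ?_
  nlinarith

/-- One more level of the tree halves the relative error of the branch conductances, since these
are at least `1`. -/
theorem branchCond_le_treeEnergy_succ {k : ℕ} {δ : ℝ} (hδ : 0 ≤ δ)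
    (h : ∀ e w, IsWalk x (e :: w) →
      branchCond (run x (e :: w)).1 e / (1 + δ) * u (run x (e :: w)) ^ 2 ≤
        treeEnergy u x k (e :: w)) (e : Fin 5) (w : List (Fin 5)) (hw : IsWalk x (e :: w)) :
    branchCond (run x (e :: w)).1 e / (1 + δ / 2) * u (run x (e :: w)) ^ 2 ≤
      treeEnergy u x (k + 1) (e :: w) := by
  have h1 := sum_le_treeEnergy hδ fun f hf => h f (e :: w) ⟨hw, hf⟩
  refine le_trans (le_of_eq ?_) h1
  have hinc : ∀ (v : Fin 3) (e : Fin 5), BaseInc v e → BaseInc (baseOpp v e) e := by decide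
  rw [← sum_edgeCond (v := (run x (e :: w)).1) (hinc (run x w).1 e (mem_next.1 hw.2).1),
    Finset.sum_div, Finset.sum_mul]
  refine Finset.sum_congr ?_ fun f _ => rfl
  ext f
  rw [mem_next, Finset.mem_filter]
  simp

theorem exists_branchCond_le (M : ℕ) [NeZero M] {ε : ℝ} (hε : 0 < ε) :
    ∃ k : ℕ, ∀ (L : ℕ) (u : Cover L M → ℝ) (x : Cover L M) (e : Fin 5) (w : List (Fin 5)),
      IsWalk x (e :: w) → branchCond (run x (e :: w)).1 e / (1 + ε) * u (run x (e :: w)) ^ 2 ≤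
        treeEnergy u x k (e :: w) := by
  have key : ∀ i : ℕ, ∀ (L : ℕ) (u : Cover L M → ℝ) (x : Cover L M) (e : Fin 5) (w : List (Fin 5)),
      IsWalk x (e :: w) →
      branchCond (run x (e :: w)).1 e / (1 + (4 * M + 3) / 2 ^ i) * u (run x (e :: w)) ^ 2 ≤
        treeEnergy u x (2 * M + 1 + i) (e :: w) := by
    intro i
    induction i with
    | zero =>
      intro L u x e w _
      have h1 := grounded (u := u) (x := x) (e :: w) _ le_rfl
      push_cast at h1
      have h2 := branchCond_le_two (run x (e :: w)).1 e
      rw [pow_zero, div_one, add_zero, div_mul_eq_mul_div, div_le_iff₀ (by positivity)]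
      nlinarith [sq_nonneg (u (run x (e :: w)))]
    | succ i ih =>
      intro L u x e w hw
      have := branchCond_le_treeEnergy_succ (δ := (4 * M + 3) / 2 ^ i) (by positivity)
        (ih L u x) e w hw
      rwa [div_div, ← pow_succ] at this
  have hlim : Tendsto (fun i : ℕ => (4 * M + 3 : ℝ) / 2 ^ i) atTop (𝓝 0) :=
    tendsto_const_nhds.div_atTop (tendsto_pow_atTop_atTop_of_one_lt one_lt_two)
  obtain ⟨i, hi⟩ := (hlim.eventually_lt_const hε).exists
  refine ⟨2 * M + 1 + i, fun L u x e w hw => (key i L u x e w hw).trans' ?_⟩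
  have := one_le_branchCond (run x (e :: w)).1 e
  gcongr

theorem exists_vertexCond_le (M : ℕ) [NeZero M] {ε : ℝ} (hε : 0 < ε) :
    ∃ k : ℕ, ∀ (L : ℕ) (u : Cover L M → ℝ) (x : Cover L M),
      vertexCond x.1 / (1 + ε) * u x ^ 2 ≤ treeEnergy u x k [] := by
  obtain ⟨k, hk⟩ := exists_branchCond_le M (ε := 2 * ε) (by linarith)
  refine ⟨k + 1, fun L u x => ?_⟩
  have := sum_le_treeEnergy (w := []) (by linarith) fun e he => hk L u x e [] ⟨trivial, he⟩
  rw [mul_div_cancel_left₀ ε two_ne_zero] at this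
  refine le_trans (le_of_eq ?_) this
  rw [← sum_edgeCond_eq_vertexCond, Finset.sum_div, Finset.sum_mul]
  refine Finset.sum_congr ?_ fun f _ => rfl
  simp [next]

/-! ### The rooted network on the cover -/

/-- The edges of the rooted network: the lifts of the five edges of the base graph, labelled by the
group element at their first end, and the edges to the root. -/
abbrev Edge (L M : ℕ) : Type := (Fin 5 × Equiv.Perm (WordBall L) × ZMod M) ⊕ Equiv.Perm (WordBall L)

/-- The first end of an edge of the rooted network. -/
def edgeSrc : Edge L M → Option (Cover L M) :=
  Sum.elim (fun e => some (baseSrc e.1, e.2)) (fun p => some (0, p, 0))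

/-- The second end of an edge of the rooted network. -/
def edgeTgt : Edge L M → Option (Cover L M) :=
  Sum.elim (fun e => some (step e.1 (baseSrc e.1, e.2))) (fun _ => none)

/-- The label of the lift of `e` through which the step from `v` along `e` passes. -/
def edgeAt (e : Fin 5) (v : Cover L M) : Fin 5 × Equiv.Perm (WordBall L) × ZMod M :=
  (e, if baseSrc e = v.1 then v.2 else (step e v).2)

theorem step_step {e : Fin 5} {v : Cover L M} (h : BaseInc v.1 e) : step e (step e v) = v := by
  obtain ⟨i, p, z⟩ := v
  have h0 : ∀ (i : Fin 3) (e : Fin 5), BaseInc i e → baseOpp (baseOpp i e) e = i ∧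
      (baseSrc e = baseOpp i e ↔ baseSrc e ≠ i) := by decide
  obtain ⟨h1, h2⟩ := h0 i e h
  simp only [step, h1, h2, ← mul_assoc, letterPerm_mul_self, one_mul]
  by_cases h3 : baseSrc e = i <;> simp [h3]

/-- The energies of `u` in the step from `v` along `e` and in the corresponding edge agree. -/
theorem edge_sq_eq (φ : Option (Cover L M) → ℝ) {e : Fin 5} {v : Cover L M} (h : BaseInc v.1 e) :
    (φ (edgeSrc (.inl (edgeAt e v))) - φ (edgeTgt (.inl (edgeAt e v)))) ^ 2 =
      (φ (some (step e v)) - φ (some v)) ^ 2 := by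
  by_cases h1 : baseSrc e = v.1
  · have : ((baseSrc e, v.2) : Cover L M) = v := by rw [h1]
    simp only [edgeSrc, edgeTgt, edgeAt, Sum.elim_inl, h1, if_true]
    ring
  · have h2 : baseSrc e = (step e v).1 := by rw [step_fst, baseOpp, if_neg h1]
    have h3 : ((baseSrc e, (step e v).2) : Cover L M) = step e v := by rw [h2]
    simp only [edgeSrc, edgeTgt, edgeAt, Sum.elim_inl, if_neg h1, h3, step_step h]

theorem edgeAt_injOn (x : Cover L M) {e f : Fin 5} {w w' : List (Fin 5)} (hw : IsWalk x (e :: w))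
    (hw' : IsWalk x (f :: w')) (hl : (e :: w).length ≤ L) (hl' : (f :: w').length ≤ L)
    (h : edgeAt e (run x w) = edgeAt f (run x w')) : e :: w = f :: w' := by
  obtain rfl : e = f := congrArg Prod.fst h
  have hg := congrArg (fun a => a.2.1) h
  simp only [edgeAt] at hg
  have c1 := hw.isChain
  have c2 := hw'.isChain
  have d1 : w.length ≤ L := (Nat.le_succ _).trans hl
  have d2 : w'.length ≤ L := (Nat.le_succ _).trans hl'
  -- if the edge is passed in both directions, then one walk ends by repeating its last edge
  by_cases h1 : baseSrc e = (run x w).1 <;> by_cases h2 : baseSrc e = (run x w').1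
  · rw [if_pos h1, if_pos h2] at hg
    rw [eq_of_run_perm_eq hw.1.isChain hw'.1.isChain d1 d2 hg]
  · rw [if_pos h1, if_neg h2] at hg
    have := eq_of_run_perm_eq hw.1.isChain c2 d1 hl' hg
    exact absurd (by rw [this]; rfl) (mem_next.1 hw.2).2
  · rw [if_neg h1, if_pos h2] at hg
    have := eq_of_run_perm_eq c1 hw'.1.isChain hl d2 hg
    exact absurd (by rw [← this]; rfl) (mem_next.1 hw'.2).2
  · rw [if_neg h1, if_neg h2] at hg
    exact eq_of_run_perm_eq c1 c2 hl hl' hg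

variable [NeZero M]

/-- The tree of short walks from `x` embeds into the network, edge by edge. -/
theorem treeEnergy_le (φ : Option (Cover L M) → ℝ) (x : Cover L M) :
    treeEnergy (fun v => φ (some v) - φ none) x L [] ≤
      ∑ e : Edge L M, (φ (edgeSrc e) - φ (edgeTgt e)) ^ 2 := by
  set u : Cover L M → ℝ := fun v => φ (some v) - φ none with hu
  have h0 := treeEnergy_eq_sum u x L []
  rw [lastEnergy, zero_add, Finset.sum_add_distrib] at h0
  rw [h0, Fintype.sum_sum_type]
  have hW : ∀ w ∈ extensions x L [], IsWalk x w ∧ w.length ≤ L := fun w hw =>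
    ⟨isWalk_of_mem_extensions (w := []) trivial hw, by
      simpa using (suffix_of_mem_extensions hw).2⟩
  refine add_le_add ?_ ?_
  · -- the last edges of the nonempty walks
    let lab : List (Fin 5) → Fin 5 × Equiv.Perm (WordBall L) × ZMod M := fun w =>
      edgeAt (w.headD 0) (run x w.tail)
    have h1 : ∑ w ∈ extensions x L [], lastEnergy u x w =
        ∑ w ∈ (extensions x L []).filter (· ≠ []),
          (φ (edgeSrc (.inl (lab w))) - φ (edgeTgt (.inl (lab w)))) ^ 2 := by
      rw [Finset.sum_filter]
      refine Finset.sum_congr rfl fun w hw => ?_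
      cases w with
      | nil => simp [lastEnergy]
      | cons e w =>
        rw [if_pos (by simp)]
        change _ = (φ (edgeSrc (.inl (edgeAt e (run x w)))) -
          φ (edgeTgt (.inl (edgeAt e (run x w))))) ^ 2
        rw [edge_sq_eq φ (mem_next.1 (hW _ hw).1.2).1]
        simp [lastEnergy, hu]
    have hinj : Set.InjOn lab ((extensions x L []).filter (· ≠ []) : Finset (List (Fin 5))) := by
      intro w hw w' hw' h
      simp only [Finset.mem_coe, Finset.mem_filter] at hw hw'
      obtain ⟨a, b, rfl⟩ := List.exists_cons_of_ne_nil hw.2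
      obtain ⟨a', b', rfl⟩ := List.exists_cons_of_ne_nil hw'.2
      exact edgeAt_injOn x (hW _ hw.1).1 (hW _ hw'.1).1 (hW _ hw.1).2 (hW _ hw'.1).2 h
    rw [h1, ← Finset.sum_image (f := fun e => (φ (edgeSrc (.inl e)) - φ (edgeTgt (.inl e))) ^ 2)
      hinj]
    exact Finset.sum_le_sum_of_subset_of_nonneg (Finset.subset_univ _) fun _ _ _ => sq_nonneg _
  · let good : Finset (List (Fin 5)) :=
      (extensions x L []).filter fun w => (run x w).1 = 0 ∧ (run x w).2.2 = 0
    have h1 : ∑ w ∈ extensions x L [], rootEnergy u (run x w) =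
        ∑ w ∈ good, (φ (edgeSrc (M := M) (.inr (run x w).2.1)) -
          φ (edgeTgt (M := M) (.inr (run x w).2.1))) ^ 2 := by
      rw [Finset.sum_filter]
      refine Finset.sum_congr rfl fun w _ => ?_
      by_cases h : (run x w).1 = 0 ∧ (run x w).2.2 = 0
      · rw [rootEnergy, if_pos h, if_pos h]
        have : run x w = (0, (run x w).2.1, 0) := Prod.ext h.1 (Prod.ext rfl h.2)
        simp only [edgeSrc, edgeTgt, Sum.elim_inr, hu]
        rw [← this]
      · rw [rootEnergy, if_neg h, if_neg h]
    have hinj : Set.InjOn (fun w => (run x w).2.1) (good : Set (List (Fin 5))) := by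
      intro w hw w' hw' h
      simp only [good, Finset.mem_coe, Finset.mem_filter] at hw hw'
      exact eq_of_run_perm_eq (hW _ hw.1).1.isChain (hW _ hw'.1).1.isChain (hW _ hw.1).2
        (hW _ hw'.1).2 h
    rw [h1, ← Finset.sum_image
      (f := fun p => (φ (edgeSrc (M := M) (.inr p)) - φ (edgeTgt (M := M) (.inr p))) ^ 2) hinj]
    exact Finset.sum_le_sum_of_subset_of_nonneg (Finset.subset_univ _) fun _ _ _ => sq_nonneg _

end Cover

/-- A cover whose tree-like balls are deep enough has total resistance to the root at most `1 + ε`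
times the sum of the resistances to infinity in the universal cover. -/
theorem exists_hasRooted_cover (M : ℕ) [NeZero M] {ε : ℝ} (hε : 0 < ε) :
    ∃ P : ℕ, 0 < P ∧ HasRooted (3 * (P * M)) (5 * (P * M) + P)
      ((1 + ε) * (P * M) * ((7 * √5 - 3) / 8)) := by
  obtain ⟨L, hL⟩ := Cover.exists_vertexCond_le M hε
  have h5 : √5 * √5 = 5 := Real.mul_self_sqrt (by norm_num)
  have h2 := Cover.two_lt_sqrt_five
  have hpos : ∀ v, 0 < Cover.vertexCond v := fun v => by
    unfold Cover.vertexCond; split_ifs <;> positivity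
  have hinv : ∑ v, 1 / Cover.vertexCond v = (7 * √5 - 3) / 8 := by
    rw [Fin.sum_univ_three]
    simp only [Cover.vertexCond, Fin.isValue, if_true, one_ne_zero, if_false, Fin.reduceEq]
    have : 1 + √5 ≠ 0 := by positivity
    field_simp
    nlinarith
  refine ⟨Fintype.card (Equiv.Perm (WordBall L)), Fintype.card_pos,
    HasRooted.of_family (ι := Cover L M) (E := Cover.Edge L M) Cover.edgeSrc Cover.edgeTgt
      (fun x => (1 + ε) * (1 / Cover.vertexCond x.1)) (fun x => ?_) (fun x φ => ?_) ?_ ?_ ?_⟩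
  · have := hpos x.1
    positivity
  · have h := (hL L (fun v => φ (some v) - φ none) x).trans (Cover.treeEnergy_le φ x)
    have hp := hpos x.1
    rw [div_mul_eq_mul_div, div_le_iff₀ (by linarith)] at h
    rw [mul_one_div, div_mul_eq_mul_div, le_div_iff₀ hp]
    linarith
  · simp [ZMod.card]
  · simp [ZMod.card]
  · rw [Fintype.sum_prod_type]
    simp only [Finset.sum_const, Finset.card_univ, Fintype.card_prod, ZMod.card, nsmul_eq_mul,
      ← Finset.mul_sum, hinv]
    push_cast
    exact le_of_eq (by ring)

/-- The block at `10 / 3` from the cover has average resistance close to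
`(7 √5 - 3) / 24 = 0.52718…`, which gives the slope `(1 - 0.52718…) / (4 / 3) = 0.35461…`; the edges
to the root and the truncation cost less than the slack. -/
theorem rootedLimit_le {α : ℝ} (hα : 2 ≤ α) (hα' : α ≤ 10 / 3) :
    rootedLimit α hα ≤ 1 - 0.354605 * (α - 2) := by
  obtain ⟨P, hP, h⟩ := exists_hasRooted_cover 1000000 (ε := 1 / 1000000) (by norm_num)
  have h5 := Cover.sqrt_five_lt
  have hP0 : (0 : ℝ) < P := by exact_mod_cast hP
  have key := rootedLimit_le_of_block h (by omega) (by omega) (by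
    push_cast
    nlinarith) hα (hα'.trans (by
      rw [le_div_iff₀ (by positivity)]
      push_cast
      nlinarith))
  refine key.trans ?_
  have h1 : (0.354605 : ℝ) ≤ (((3 * (P * 1000000) : ℕ) : ℝ) -
      (1 + 1 / 1000000) * (P * (1000000 : ℕ)) * ((7 * √5 - 3) / 8)) /
      (2 * (((5 * (P * 1000000) + P : ℕ) : ℝ) - (3 * (P * 1000000) : ℕ))) := by
    rw [le_div_iff₀ (by push_cast; nlinarith)]
    push_cast
    nlinarith
  nlinarith

/-! ### The unrooted problem -/

/-- The summand `1` is a margin that spares the attainment of the infimum `minRooted 3 n`. -/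
theorem optResistance_succ_le (n : ℕ) :
    optResistance 3 (n + 1) ≤ ENNReal.ofReal (2 * (minRooted 3 n + 1) / (n + 1)) := by
  obtain ⟨T, hT, hlt⟩ := exists_lt_of_csInf_lt (nonempty_hasRooted (α := 3) (by norm_num) n)
    (lt_add_one (minRooted 3 n))
  obtain ⟨G, hm, hG⟩ := HasRooted.exists_sum_resistance_le hT
  refine (iInf₂_le G ?_).trans ?_
  · have h1 := Nat.floor_le (a := 3 * (n : ℝ) / 2) (by positivity)
    have h2 : (G.numEdges : ℝ) ≤ (⌊3 * (n : ℝ) / 2⌋₊ : ℕ) := by exact_mod_cast hm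
    push_cast
    linarith
  · have hn : (0 : ℝ) < ((n + 1 : ℕ) : ℝ) ^ 2 := by positivity
    rw [avgResistance', ← ENNReal.ofReal_natCast (n + 1), ← ENNReal.ofReal_pow (by positivity)]
    refine (ENNReal.div_le_div_right hG _).trans ?_
    rw [← ENNReal.ofReal_div_of_pos hn]
    refine ENNReal.ofReal_le_ofReal ?_
    have : 2 * ((n : ℝ) + 1) * T / ((n + 1 : ℕ) : ℝ) ^ 2 = 2 * T / (n + 1) := by
      push_cast
      field_simp
    rw [this]
    gcongr

/-- A network is turned into a rooted one with `n - k + 3 k` vertices: the contraction of `k`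
vertices to the root saves no edges, and `3 k` leaves at the root bring the ratio of edges to
vertices back to `3 / 2`. -/
theorem le_optResistance {n s : ℕ} (hn : 0 < n) (hs : 0 < s) (h3 : (2 : ℝ) ≤ 3) :
    ENNReal.ofReal ((rootedLimit 3 h3 - 3 * (s + 1) / n) / (1 / 2 + 1 / √s)) ≤
      optResistance 3 n := by
  refine le_iInf₂ fun G hG => ?_
  have hn0 : (0 : ℝ) < n := by exact_mod_cast hn
  by_cases htop : ∑ x, ∑ y, G.resistance x y = ⊤
  · rw [avgResistance', htop, ENNReal.top_div_of_ne_top (by simp)]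
    exact le_top
  have hR : ∀ x y, G.resistance x y ≠ ⊤ := fun x y => by
    have := ENNReal.sum_ne_top.1 htop x (Finset.mem_univ x)
    rw [ENNReal.sum_ne_top] at this
    exact this y (Finset.mem_univ y)
  have hsum : ∑ x, ∑ y, G.resistance x y =
      ENNReal.ofReal (∑ x, ∑ y, (G.resistance x y).toReal) := by
    rw [← ENNReal.ofReal_toReal htop, ENNReal.toReal_sum fun x _ => by
      rw [ENNReal.sum_ne_top]; exact fun y _ => hR x y]
    congr 1
    exact Finset.sum_congr rfl fun x _ => ENNReal.toReal_sum fun y _ => hR x y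
  obtain ⟨k, hkn, hks, hk⟩ := G.exists_hasRooted hn hR hs
  have hT0 : 0 ≤ ∑ x, ∑ y, (G.resistance x y).toReal :=
    Finset.sum_nonneg fun x _ => Finset.sum_nonneg fun y _ => ENNReal.toReal_nonneg
  rw [avgResistance', hsum, ← ENNReal.ofReal_natCast n, ← ENNReal.ofReal_pow hn0.le,
    ← ENNReal.ofReal_div_of_pos (by positivity)]
  set T := ∑ x, ∑ y, (G.resistance x y).toReal
  refine ENNReal.ofReal_le_ofReal ?_
  set c : ℝ := 1 / 2 + 1 / √s with hc
  have hc0 : 0 < c := by positivity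
  rw [div_le_iff₀ hc0]
  have h1 := minRooted_le (α := 3) (hk.add (HasRooted.star (3 * k))) (by
    push_cast [Nat.cast_sub hkn]
    linarith)
  have h2 := rootedLimit_le_div h3 (n := n - k + 3 * k) (by omega)
  have hN : (n : ℝ) ≤ ((n - k + 3 * k : ℕ) : ℝ) := by exact_mod_cast (by omega)
  have hks' : (k : ℝ) ≤ s + 1 := by exact_mod_cast hks
  have h4 : minRooted 3 (n - k + 3 * k) / ((n - k + 3 * k : ℕ) : ℝ) ≤
      (T / n * c + 3 * (s + 1)) / n := by
    push_cast at h1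
    have : minRooted 3 (n - k + 3 * k) ≤ T / n * c + 3 * (s + 1) := by linarith
    exact div_le_div₀ (by positivity) this hn0 hN
  have h5 : (T / n * c + 3 * (s + 1)) / n = T / n ^ 2 * c + 3 * (s + 1) / n := by
    field_simp
  linarith

theorem tendsto_optResistance (h3 : (2 : ℝ) ≤ 3) :
    Tendsto (optResistance 3) atTop (𝓝 (ENNReal.ofReal (2 * rootedLimit 3 h3))) := by
  set b := rootedLimit 3 h3
  have hsqrt : Tendsto Nat.sqrt atTop atTop := by
    refine tendsto_atTop_atTop.2 fun a => ⟨a * a, fun n hn => Nat.le_sqrt.2 hn⟩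
  have hinv : Tendsto (fun n : ℕ => 1 / √(n : ℝ)) atTop (𝓝 0) :=
    tendsto_const_nhds.div_atTop (Real.tendsto_sqrt_atTop.comp tendsto_natCast_atTop_atTop)
  have hsmall : Tendsto (fun n : ℕ => 3 * ((Nat.sqrt n : ℝ) + 1) / n) atTop (𝓝 0) := by
    have hub : Tendsto (fun n : ℕ => 3 * (1 / √(n : ℝ)) + 3 * (1 / (n : ℝ))) atTop (𝓝 0) := by
      simpa using (hinv.const_mul 3).add (tendsto_one_div_atTop_nhds_zero_nat.const_mul 3)
    refine squeeze_zero (fun n => by positivity) (fun n => ?_) hub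
    have h1 : (Nat.sqrt n : ℝ) ≤ √n := Real.nat_sqrt_le_real_sqrt
    have h2 : 1 / √(n : ℝ) = √n / n := by rw [Real.sqrt_div_self', one_div]
    rw [h2, ← mul_add, ← add_div, mul_div_assoc]
    gcongr
  have hlow : Tendsto (fun n : ℕ => ENNReal.ofReal
      ((b - 3 * ((Nat.sqrt n : ℝ) + 1) / n) / (1 / 2 + 1 / √(Nat.sqrt n : ℝ)))) atTop
      (𝓝 (ENNReal.ofReal (2 * b))) := by
    refine ENNReal.tendsto_ofReal ?_
    have h1 := (hsmall.const_sub b).div ((hinv.comp hsqrt).const_add (1 / 2)) (by norm_num)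
    have h2 : (b - 0) / (1 / 2 + 0) = 2 * b := by ring
    rw [h2] at h1
    exact h1
  have hup : Tendsto (fun n : ℕ => ENNReal.ofReal (2 * (minRooted 3 n + 1) / (n + 1))) atTop
      (𝓝 (ENNReal.ofReal (2 * b))) := by
    refine ENNReal.tendsto_ofReal ?_
    have h1 := (tendsto_minRooted h3).add tendsto_one_div_atTop_nhds_zero_nat
    have h2 := (h1.mul (tendsto_natCast_div_add_atTop (1 : ℝ))).const_mul 2
    rw [add_zero, mul_one] at h2
    refine h2.congr' ?_
    filter_upwards [eventually_ne_atTop 0] with n hn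
    have : (n : ℝ) ≠ 0 := by exact_mod_cast hn
    field_simp
  rw [← tendsto_add_atTop_iff_nat 1]
  refine tendsto_of_tendsto_of_tendsto_of_le_of_le ((tendsto_add_atTop_iff_nat 1).2 hlow) hup
    (fun n => ?_) optResistance_succ_le
  exact le_optResistance n.succ_pos (Nat.sqrt_pos.2 n.succ_pos) h3

namespace Multigraph

theorem two_mul_sum_lt_le {n : ℕ} (G : Multigraph (Fin n)) :
    2 * ∑ x : Fin n, ∑ y : Fin n with x < y, G.resistance x y ≤ ∑ x, ∑ y, G.resistance x y := by
  have h1 : ∑ x : Fin n, ∑ y : Fin n with x < y, G.resistance x y =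
      ∑ x : Fin n, ∑ y : Fin n with y < x, G.resistance x y := by
    simp only [Finset.sum_filter]
    rw [Finset.sum_comm]
    exact Finset.sum_congr rfl fun x _ => Finset.sum_congr rfl fun y _ => by
      rw [G.resistance_comm]
  rw [two_mul]
  nth_rewrite 2 [h1]
  rw [← Finset.sum_add_distrib]
  refine Finset.sum_le_sum fun x _ => ?_
  rw [← Finset.sum_union (Finset.disjoint_filter.2 fun y _ h h' => lt_asymm h h')]
  exact Finset.sum_le_sum_of_subset (Finset.subset_univ _)

theorem avgResistance_le {n : ℕ} (hn : 1 < n) {G : Multigraph (Fin n)} {c : ℝ}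
    (h : G.avgResistance' ≤ ENNReal.ofReal c) (hc : 0 ≤ c) :
    G.avgResistance ≤ ENNReal.ofReal (c * (n / (n - 1))) := by
  have hn1 : (0 : ℝ) < (n : ℝ) - 1 := sub_pos.2 (by exact_mod_cast hn)
  have hn0 : (0 : ℝ) < n := by linarith
  have hch : (0 : ℝ) < (n.choose 2 : ℕ) := by
    exact_mod_cast Nat.choose_pos hn
  rw [avgResistance', ENNReal.div_le_iff (by simp; omega) (by simp), ← ENNReal.ofReal_natCast n,
    ← ENNReal.ofReal_pow hn0.le, ← ENNReal.ofReal_mul hc] at h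
  rw [avgResistance, ENNReal.div_le_iff (by exact_mod_cast hch.ne') (by simp),
    ← ENNReal.ofReal_natCast (n.choose 2), ← ENNReal.ofReal_mul (by positivity)]
  have h2 := G.two_mul_sum_lt_le.trans h
  have h3 : ENNReal.ofReal (c * n ^ 2) =
      2 * ENNReal.ofReal (c * (n / (n - 1)) * (n.choose 2 : ℕ)) := by
    rw [← ENNReal.ofReal_ofNat 2, ← ENNReal.ofReal_mul zero_le_two, Nat.cast_choose_two]
    congr 1
    field_simp
  rw [h3] at h2
  exact (ENNReal.mul_le_mul_iff_right (by simp) (by simp)).1 h2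

end Multigraph

theorem theorem5p4 :
    -- for `α ∈ [2, 10/3]` the limit `b(α)` exists and is at most `1 - 0.3546 (α - 2)`
    (∀ α : ℝ, 2 ≤ α → α ≤ 10 / 3 →
      Tendsto (optRootedResistance α) atTop (𝓝 (asympRootedResistance α)) ∧
      asympRootedResistance α ≤ ENNReal.ofReal (1 - 0.3546 * (α - 2))) ∧
    -- in particular `b(3) ≤ 0.6454`
    asympRootedResistance 3 ≤ ENNReal.ofReal 0.6454 ∧
    -- the limit `a(3)` exists and is at most `1.2908`
    (Tendsto (optResistance 3) atTop (𝓝 (asympResistance 3)) ∧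
      asympResistance 3 ≤ ENNReal.ofReal 1.2908) ∧
    -- for all large `n` there is a graph with `n` vertices, `≤ 3n/2` edges and `A(G) < 1.2908`
    (∀ᶠ n : ℕ in atTop, ∃ G : Multigraph (Fin n),
      (G.numEdges : ℝ) ≤ 3 * n / 2 ∧ G.avgResistance < ENNReal.ofReal 1.2908) := by
  have h3 : (2 : ℝ) ≤ 3 := by norm_num
  have hb : ∀ (α : ℝ) (hα : 2 ≤ α), asympRootedResistance α = ENNReal.ofReal (rootedLimit α hα) :=
    fun α hα => (tendsto_optRootedResistance hα).limUnder_eq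
  have ha : asympResistance 3 = ENNReal.ofReal (2 * rootedLimit 3 h3) :=
    (tendsto_optResistance h3).limUnder_eq
  have hle := rootedLimit_le h3 (by norm_num)
  refine ⟨fun α hα hα' => ⟨?_, ?_⟩, ?_, ⟨?_, ?_⟩, ?_⟩
  · rw [hb α hα]
    exact tendsto_optRootedResistance hα
  · rw [hb α hα]
    refine ENNReal.ofReal_le_ofReal ((rootedLimit_le hα hα').trans ?_)
    linarith
  · rw [hb 3 h3]
    exact ENNReal.ofReal_le_ofReal (by linarith)
  · rw [ha]
    exact tendsto_optResistance h3
  · rw [ha]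
    exact ENNReal.ofReal_le_ofReal (by linarith)
  · -- the slack `1.2908 - 1.290795` absorbs the factor `n / (n - 1)` between the two averages
    have hlt : ENNReal.ofReal (2 * rootedLimit 3 h3) < ENNReal.ofReal 1.290795 :=
      (ENNReal.ofReal_lt_ofReal_iff (by norm_num)).2 (by linarith)
    filter_upwards [(tendsto_optResistance h3).eventually_lt_const hlt,
      eventually_ge_atTop 1000000] with n hn hN
    obtain ⟨G, hG⟩ := iInf_lt_iff.1 hn
    obtain ⟨hm, hG⟩ := iInf_lt_iff.1 hG
    refine ⟨G, hm, (avgResistance_le (by omega) hG.le (by norm_num)).trans_lt ?_⟩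
    have hN' : (1000000 : ℝ) ≤ n := by exact_mod_cast hN
    refine (ENNReal.ofReal_lt_ofReal_iff (by norm_num)).2 ?_
    rw [mul_div_assoc', div_lt_iff₀ (by linarith)]
    linarith
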